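/- Let $\pi$ be a finitely generated torsion-free nilpotent group and let $\phi:\pi\to\pi$ be an endomorphism (not necessarily an automorphism). For an endomorphism $\psi$ of a group $\Gamma$ with a finite generating set $S$, let $L(\gamma,S)$ denote the word length of $\gamma\in\Gamma$ with respect to $S\cup S^{-1}$, and let $$\mathrm{GR}(\psi)=\sup_{\gamma\in\Gamma}\ \limsup_{k\to\infty}L(\psi^k(\gamma),S)^{1/k}$$ be the growth rate of $\psi$. Let $\phi_{\mathrm{ab}}$ be the endomorphism of $\pi/[\pi,\pi]$ induced by $\phi$. Then, for every choice of finite generating sets of $\pi$ and of $\pi/[\pi,\pi]$, $$\mathrm{GR}(\phi)=\mathrm{GR}(\phi_{\mathrm{ab}}).$$ Further, let $\sqrt{[\pi,\pi]}=\{x\in\pi\mid x^m\in[\pi,\pi]\text{ for some }m\ge1\}$, choose an isomorphism $\pi/\sqrt{[\pi,\pi]}\cong\mathbb{Z}^{k}$, and let $D_1$ be the integer $k\times k$ matrix that represents the endomorphism of $\pi/\sqrt{[\pi,\pi]}$ induced by $\phi$. Write $\mathrm{sp}$ for the maximum of the absolute values of the complex eigenvalues ($0$ in dimension $0$). Then $$\mathrm{GR}(\phi)=\mathrm{sp}(D_1).$$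 Let moreover $G$ be a Malcev completion of $\pi$, that is, a connected simply connected nilpotent real Lie group that contains $\pi$ as a lattice (a discrete cocompact subgroup), let $D:G\to G$ be the Malcev completion of $\phi$, that is, the Lie group endomorphism that extends $\phi$, and let $D_*$, the linearization of $\phi$, be the differential of $D$ at the identity, an endomorphism of the Lie algebra $\mathfrak G$ of $G$. Then $$\mathrm{GR}(\phi)=\mathrm{sp}(D_1)\le\mathrm{sp}(D_*).$$ Here $D_1$ is the first diagonal block of the linearization in the following sense: if $Q:G\to\mathbb{R}^{k}$ is the Lie group homomorphism that extends the projection $\pi\to\pi/\sqrt{[\pi,\pi]}\cong\mathbb{Z}^{k}\subset\mathbb{R}^k$, with differential $Q_*$, then $\mathfrak G$ has a basis whose first $k$ vectors are mapped by $Q_*$ to the standard basis of $\mathbb{R}^k$ and whose other vectors lie in $\ker Q_*$, and in this basis $D_*$ is a lower triangular block matrix with first diagonal block $D_1$. -/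

import Mathlib

open Filter Module
open scoped Manifold ContDiff ENNReal

/-- The length `L(γ, S)` of the shortest word in the letters `S ∪ S⁻¹` that represents `γ`.
(It is meaningful when `S` generates the group.) -/
noncomputable def wordLength {π : Type*} [Group π] (S : Set π) (γ : π) : ℕ :=
  sInf {n : ℕ | ∃ w : List π, w.length = n ∧ (∀ x ∈ w, x ∈ S ∨ x⁻¹ ∈ S) ∧ w.prod = γ}

/-- The growth rate `sup_γ limsup_k L(φ^k(γ), S)^(1/k)` of an endomorphism `φ`, computed with the
generating set `S`, as an extended nonnegative real (so no supremum has a junk value). -/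
noncomputable def growthRate {π : Type*} [Group π] (S : Set π) (φ : π →* π) : ℝ≥0∞ :=
  ⨆ γ : π, limsup (fun k : ℕ => (wordLength S (φ^[k] γ) : ℝ≥0∞) ^ (1 / (k : ℝ))) atTop

/-- The maximum of the absolute values of the complex roots of a polynomial
(`0` if there are none). -/
noncomputable def maxAbsRoot {R : Type*} [CommRing R] [Algebra R ℂ] (p : Polynomial R) : ℝ :=
  sSup {r : ℝ | ∃ μ ∈ p.aroots ℂ, ‖μ‖ = r}

/-- `sp(A)` for an integer matrix: the maximum of the absolute values of its complex
eigenvalues. -/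
noncomputable def spMatrix {k : ℕ} (A : Matrix (Fin k) (Fin k) ℤ) : ℝ :=
  maxAbsRoot A.charpoly

/-- `sp(T)` for an endomorphism of a finite-dimensional real vector space: the maximum of the
absolute values of its complex eigenvalues. -/
noncomputable def spLinear {V : Type*} [AddCommGroup V] [Module ℝ V] [FiniteDimensional ℝ V]
    (T : V →ₗ[ℝ] V) : ℝ :=
  maxAbsRoot T.charpoly

/-- The isolator `√[π,π]` of the commutator subgroup `[π,π]` in `π`: the elements some positive
power of which lies in `[π,π]`, that is, the elements which are torsion in the abelianization. -/
def isolator (π : Type*) [Group π] : Subgroup π :=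
  (CommGroup.torsion (Abelianization π)).comap Abelianization.of

theorem mem_isolator_iff {π : Type*} [Group π] (x : π) :
    x ∈ isolator π ↔ ∃ m : ℕ, 1 ≤ m ∧ x ^ m ∈ commutator π := by
  have key : ∀ m : ℕ, (Abelianization.of x) ^ m = 1 ↔ x ^ m ∈ commutator π := by
    intro m
    rw [← map_pow, ← MonoidHom.mem_ker, Abelianization.ker_of]
  change IsOfFinOrder (Abelianization.of x) ↔ _
  rw [isOfFinOrder_iff_pow_eq_one]
  constructor
  · rintro ⟨m, hm, h⟩
    exact ⟨m, hm, (key m).1 h⟩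
  · rintro ⟨m, hm, h⟩
    exact ⟨m, hm, (key m).2 h⟩

instance isolator_normal (π : Type*) [Group π] : (isolator π).Normal :=
  Subgroup.Normal.comap inferInstance _

theorem isolator_le_comap {π : Type*} [Group π] (φ : π →* π) :
    isolator π ≤ (isolator π).comap φ := by
  intro x hx
  rw [mem_isolator_iff] at hx
  obtain ⟨m, hm, h⟩ := hx
  rw [Subgroup.mem_comap, mem_isolator_iff]
  refine ⟨m, hm, ?_⟩
  rw [← map_pow]
  have := Subgroup.mem_map_of_mem φ h
  rw [commutator_def, Subgroup.map_commutator] at this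
  exact Subgroup.commutator_mono le_top le_top this

/-- The endomorphism of `π / √[π,π]` induced by `φ`. -/
def inducedOnFree {π : Type*} [Group π] (φ : π →* π) : π ⧸ isolator π →* π ⧸ isolator π :=
  QuotientGroup.map _ _ φ (isolator_le_comap φ)

/-- `D₁` is the integer matrix representing the endomorphism of `π / √[π,π]` induced by `φ`, in
the coordinates `e : π / √[π,π] ≅ ℤᵏ`; column `i` of `D₁` is the image of the `i`-th basis
vector. -/
def Represents {π : Type*} [Group π] (φ : π →* π) {k : ℕ}
    (e : π ⧸ isolator π ≃* Multiplicative (Fin k → ℤ)) (D₁ : Matrix (Fin k) (Fin k) ℤ) : Prop :=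
  ∀ x, (e (inducedOnFree φ x)).toAdd = D₁.mulVec (e x).toAdd

section Lie

variable {E : Type*} [NormedAddCommGroup E] [NormedSpace ℝ E]
  {G : Type*} [TopologicalSpace G] [ChartedSpace E G] [Group G]

/-- The (real) Lie group `G` together with `ι : π → G` is a Malcev completion of `π`: `G` is
connected, simply connected and nilpotent, and `ι` embeds `π` as a lattice, i.e. as a discrete
cocompact subgroup. (Mathlib's simply connected spaces are path connected.) -/
structure IsMalcevCompletion {π : Type*} [Group π] (ι : π →* G) : Prop where
  simplyConnected : SimplyConnectedSpace G
  nilpotent : Group.IsNilpotent G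
  injective : Function.Injective ι
  discrete : DiscreteTopology ι.range
  cocompact : CompactSpace (G ⧸ ι.range)

/-- `D` is the Malcev completion of the endomorphism `φ`: a Lie group endomorphism of `G` that
extends `φ`. -/
structure IsMalcevExtension {π : Type*} [Group π] (ι : π →* G) (φ : π →* π) (D : G →* G) :
    Prop where
  smooth : ContMDiff 𝓘(ℝ, E) 𝓘(ℝ, E) ∞ D
  extends_hom : ∀ x, D (ι x) = ι (φ x)

/-- The linearization `D_*`: the differential of `D` at the identity, as an endomorphism of the
Lie algebra `T₁G`. (`D 1 = 1`, and the tangent space of `G` at any point is by definition `E`,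
through the preferred chart at that point.) -/
noncomputable def linearization (E : Type*) [NormedAddCommGroup E] [NormedSpace ℝ E]
    {G : Type*} [TopologicalSpace G] [ChartedSpace E G] [Group G] (D : G →* G) :
    GroupLieAlgebra 𝓘(ℝ, E) G →ₗ[ℝ] GroupLieAlgebra 𝓘(ℝ, E) G :=
  (mfderiv 𝓘(ℝ, E) 𝓘(ℝ, E) D (1 : G) :
    GroupLieAlgebra 𝓘(ℝ, E) G →L[ℝ] GroupLieAlgebra 𝓘(ℝ, E) G).toLinearMap

/-- `Q` is the extension to `G` of the projection `π → π / √[π,π] ≅ ℤᵏ`: a Lie group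
homomorphism `G → ℝᵏ` whose restriction to `π` is that projection. -/
structure IsProjectionExtension {π : Type*} [Group π] (ι : π →* G) {k : ℕ}
    (e : π ⧸ isolator π ≃* Multiplicative (Fin k → ℤ)) (Q : G → (Fin k → ℝ)) : Prop where
  smooth : ContMDiff 𝓘(ℝ, E) 𝓘(ℝ, Fin k → ℝ) ∞ Q
  map_mul : ∀ g h, Q (g * h) = Q g + Q h
  extends_proj : ∀ x i, Q (ι x) i = (((e (x : π ⧸ isolator π)).toAdd i : ℤ) : ℝ)

instance finiteDimensional_groupLieAlgebra [FiniteDimensional ℝ E] :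
    FiniteDimensional ℝ (GroupLieAlgebra 𝓘(ℝ, E) G) :=
  inferInstanceAs (FiniteDimensional ℝ E)

/-- The differential at the identity of a map `Q : G → ℝᵏ`. -/
noncomputable def differentialAtOne (E : Type*) [NormedAddCommGroup E] [NormedSpace ℝ E]
    {G : Type*} [TopologicalSpace G] [ChartedSpace E G] [Group G] {k : ℕ}
    (Q : G → (Fin k → ℝ)) : GroupLieAlgebra 𝓘(ℝ, E) G →ₗ[ℝ] (Fin k → ℝ) :=
  (mfderiv 𝓘(ℝ, E) 𝓘(ℝ, Fin k → ℝ) Q (1 : G) :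
    GroupLieAlgebra 𝓘(ℝ, E) G →L[ℝ] (Fin k → ℝ)).toLinearMap

end Lie

/-- In some basis of `V` adapted to the linear map `q : V → ℝᵏ` (the first `k` basis vectors are
mapped by `q` to the standard basis of `ℝᵏ`, the others form a basis of the kernel of `q`), the
endomorphism `T` is given by a lower triangular block matrix with first diagonal block `D₁`. -/
def HasFirstDiagonalBlock {V : Type*} [AddCommGroup V] [Module ℝ V] {k : ℕ}
    (T : V →ₗ[ℝ] V) (q : V →ₗ[ℝ] (Fin k → ℝ)) (D₁ : Matrix (Fin k) (Fin k) ℤ) : Prop :=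
  ∃ (m : ℕ) (b : Basis (Fin k ⊕ Fin m) ℝ V)
    (B : Matrix (Fin m) (Fin k) ℝ) (C : Matrix (Fin m) (Fin m) ℝ),
    (∀ i, q (b (Sum.inl i)) = Pi.single i 1) ∧ (∀ j, q (b (Sum.inr j)) = 0) ∧
    LinearMap.toMatrix b b T = Matrix.fromBlocks (D₁.map (Int.cast : ℤ → ℝ)) 0 B C

/-! Everything is reduced to bounds on word lengths along orbits.

Lower bound: a homomorphism onto `ℤᵏ` is Lipschitz for word length, so if orbits grow more slowly
than `r ^ m`, the entries of `D₁ ^ m` are `O(r ^ m)` and no eigenvalue exceeds `r` in absolute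
value. This works for `φ` and for its abelianization alike (`ofReal_spMatrix_le_growthRate`).

Upper bound: let `r > sp(D₁)`. If `sp(D₁) ≥ 1`, Gelfand's formula bounds orbits modulo `[π,π]`; the
finite torsion costs only a constant. One then descends the lower central series. Modulo the next
term, `⁅φ^k x, φ^k y⁆` depends only on its entries modulo the current term, and the length of a
commutator is at most twice the sum of the lengths of its entries. Hence deeper layers grow no
faster (`OrbitGrowthLE.of_mem_lowerCentralSeries`), and `OrbitGrowthLE.of_extension` glues the
layers at the price of an arbitrarily small increase of the rate. If `sp(D₁) < 1`, integrality makes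
`D₁` nilpotent, and nilpotency and torsion-freeness of `π` then make an iterate of `φ` trivial. The
abelianization inherits the upper bound as a quotient of `π`.

The inequality `sp(D₁) ≤ sp(D_*)` follows from `GR(φ) ≤ sp(D_*)`, which is geometric: a lattice
element is a product of `O(N)` elements of size `1/N` in `G`; an iterate of `D` expands small
elements at a rate close to `sp(D_*)`; and a lattice element that is a product of `n` elements of a
compact set has word length `O(n)`.

For the block form, `Q ∘ D - D₁ Q` is a continuous homomorphism vanishing on a cocompact subgroup,
so it is zero; its differential gives `Q_* D_* = D₁ Q_*`, with `Q_*` surjective. -/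

open scoped commutatorElement Pointwise

/-! ### Word length. -/

section WordLength

variable {π : Type*} [Group π] {S : Set π}

theorem exists_word_of_closure_eq_top (hS : Subgroup.closure S = ⊤) (γ : π) :
    ∃ w : List π, w.length = wordLength S γ ∧ (∀ x ∈ w, x ∈ S ∨ x⁻¹ ∈ S) ∧ w.prod = γ := by
  have hne : {n : ℕ | ∃ w : List π, w.length = n ∧ (∀ x ∈ w, x ∈ S ∨ x⁻¹ ∈ S) ∧
      w.prod = γ}.Nonempty := by
    have hγ : γ ∈ Submonoid.closure (S ∪ S⁻¹) := by
      rw [← Subgroup.closure_toSubmonoid, hS]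
      trivial
    obtain ⟨w, hw, rfl⟩ := Submonoid.exists_list_of_mem_closure hγ
    exact ⟨_, w, rfl, fun x hx => by simpa using hw x hx, rfl⟩
  exact Nat.sInf_mem hne

theorem wordLength_prod_le {w : List π} (hw : ∀ x ∈ w, x ∈ S ∨ x⁻¹ ∈ S) :
    wordLength S w.prod ≤ w.length :=
  Nat.sInf_le ⟨w, rfl, hw, rfl⟩

@[simp] theorem wordLength_one : wordLength S (1 : π) = 0 :=
  Nat.le_zero.1 (wordLength_prod_le (S := S) (w := []) (by simp))

theorem wordLength_le_one {s : π} (hs : s ∈ S) : wordLength S s ≤ 1 := by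
  simpa using wordLength_prod_le (S := S) (w := [s]) (by simpa using Or.inl hs)

theorem wordLength_mul_le (hS : Subgroup.closure S = ⊤) (x y : π) :
    wordLength S (x * y) ≤ wordLength S x + wordLength S y := by
  obtain ⟨v, hv, hvS, rfl⟩ := exists_word_of_closure_eq_top hS x
  obtain ⟨w, hw, hwS, rfl⟩ := exists_word_of_closure_eq_top hS y
  rw [← hv, ← hw, ← List.length_append, ← List.prod_append]
  refine wordLength_prod_le fun z hz => ?_
  rcases List.mem_append.1 hz with h | h
  exacts [hvS z h, hwS z h]

theorem wordLength_inv_le (hS : Subgroup.closure S = ⊤) (x : π) :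
    wordLength S x⁻¹ ≤ wordLength S x := by
  obtain ⟨v, hv, hvS, rfl⟩ := exists_word_of_closure_eq_top hS x
  rw [← hv, List.prod_inv_reverse]
  refine (wordLength_prod_le fun z hz => ?_).trans (by simp)
  simp only [List.mem_reverse, List.mem_map] at hz
  obtain ⟨a, ha, rfl⟩ := hz
  simpa using (hvS a ha).symm

/-- The bound is additive, not multiplicative, in the two lengths. This is why passing to deeper
commutators does not raise the exponential rate. -/
theorem wordLength_commutator_le (hS : Subgroup.closure S = ⊤) (x y : π) :
    wordLength S ⁅x, y⁆ ≤ 2 * (wordLength S x + wordLength S y) := by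
  rw [commutatorElement_def]
  have h1 := wordLength_mul_le hS (x * y * x⁻¹) y⁻¹
  have h2 := wordLength_mul_le hS (x * y) x⁻¹
  have h3 := wordLength_mul_le hS x y
  have h4 := wordLength_inv_le hS x
  have h5 := wordLength_inv_le hS y
  omega

theorem wordLength_zpow_le (hS : Subgroup.closure S = ⊤) (x : π) (n : ℤ) :
    wordLength S (x ^ n) ≤ n.natAbs * wordLength S x := by
  have key : ∀ n : ℕ, wordLength S (x ^ n) ≤ n * wordLength S x := by
    intro n
    induction n with
    | zero => simp
    | succ n ih =>
      rw [pow_succ, Nat.succ_mul]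
      exact (wordLength_mul_le hS _ _).trans (Nat.add_le_add_right ih _)
  cases n with
  | ofNat n => simpa using key n
  | negSucc n =>
    rw [zpow_negSucc]
    exact (wordLength_inv_le hS _).trans (by simpa using key (n + 1))

theorem wordLength_list_prod_le (hS : Subgroup.closure S = ⊤) (l : List π) :
    wordLength S l.prod ≤ (l.map (wordLength S)).sum := by
  induction l with
  | nil => simp
  | cons a l ih =>
    rw [List.prod_cons, List.map_cons, List.sum_cons]
    exact (wordLength_mul_le hS _ _).trans (Nat.add_le_add_left ih _)

/-- A subadditive symmetric real function bounded on the generators is bounded by a multiple of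
the word length. -/
theorem le_mul_wordLength (hS : Subgroup.closure S = ⊤) {f : π → ℝ} {C : ℝ} (h1 : f 1 ≤ 0)
    (hmul : ∀ x y, f (x * y) ≤ f x + f y) (hinv : ∀ x, f x⁻¹ ≤ f x) (hC : ∀ s ∈ S, f s ≤ C)
    (x : π) : f x ≤ C * wordLength S x := by
  obtain ⟨v, hv, hvS, rfl⟩ := exists_word_of_closure_eq_top hS x
  rw [← hv]
  clear hv
  induction v with
  | nil => simpa using h1
  | cons a l ih =>
    have hl := ih fun x hx => hvS x (List.mem_cons_of_mem _ hx)
    have ha : f a ≤ C := by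
      rcases hvS a (by simp) with h | h
      · exact hC a h
      · have := hinv a⁻¹
        rw [inv_inv] at this
        exact this.trans (hC _ h)
    rw [List.prod_cons, List.length_cons]
    push_cast
    linarith [hmul a l.prod]

end WordLength

/-! ### Exponential bounds on orbits modulo a subgroup. -/

/-- The `f`-orbit of `x` is represented modulo `N` by elements of word length `O(r ^ k)`. -/
def OrbitGrowthLE {π : Type*} [Group π] (S : Set π) (f : π → π) (N : Subgroup π) (r : ℝ)
    (x : π) : Prop :=
  ∃ C : ℝ, ∀ k : ℕ, ∃ w : π, w⁻¹ * f^[k] x ∈ N ∧ (wordLength S w : ℝ) ≤ C * r ^ k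

namespace OrbitGrowthLE

variable {π : Type*} [Group π] {S : Set π} {N : Subgroup π} {r : ℝ} {x y : π}

theorem exists_nonneg {f : π → π} (hr : 0 < r) (h : OrbitGrowthLE S f N r x) :
    ∃ C : ℝ, 0 ≤ C ∧ ∀ k : ℕ, ∃ w : π, w⁻¹ * f^[k] x ∈ N ∧
      (wordLength S w : ℝ) ≤ C * r ^ k := by
  obtain ⟨C, hC⟩ := h
  refine ⟨max C 0, le_max_right _ _, fun k => ?_⟩
  obtain ⟨w, hw, hl⟩ := hC k
  exact ⟨w, hw, hl.trans (mul_le_mul_of_nonneg_right (le_max_left _ _) (by positivity))⟩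

theorem one (φ : π →* π) : OrbitGrowthLE S φ N r 1 :=
  ⟨0, fun k => ⟨1, by simp [iterate_map_one], by simp⟩⟩

theorem mul [N.Normal] (hS : Subgroup.closure S = ⊤) {φ : π →* π}
    (hx : OrbitGrowthLE S φ N r x) (hy : OrbitGrowthLE S φ N r y) :
    OrbitGrowthLE S φ N r (x * y) := by
  obtain ⟨C, hC⟩ := hx
  obtain ⟨D, hD⟩ := hy
  refine ⟨C + D, fun k => ?_⟩
  obtain ⟨v, hv, hvl⟩ := hC k
  obtain ⟨w, hw, hwl⟩ := hD k
  refine ⟨v * w, ?_, ?_⟩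
  · rw [← QuotientGroup.eq] at hv hw ⊢
    rw [iterate_map_mul, QuotientGroup.mk_mul, QuotientGroup.mk_mul, hv, hw]
  · have : (wordLength S (v * w) : ℝ) ≤ wordLength S v + wordLength S w :=
      mod_cast wordLength_mul_le hS v w
    linarith

theorem inv [N.Normal] (hS : Subgroup.closure S = ⊤) {φ : π →* π}
    (hx : OrbitGrowthLE S φ N r x) : OrbitGrowthLE S φ N r x⁻¹ := by
  obtain ⟨C, hC⟩ := hx
  refine ⟨C, fun k => ?_⟩
  obtain ⟨v, hv, hvl⟩ := hC k
  refine ⟨v⁻¹, ?_, ?_⟩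
  · rw [← QuotientGroup.eq] at hv ⊢
    rw [iterate_map_inv, QuotientGroup.mk_inv, QuotientGroup.mk_inv, hv]
  · have : (wordLength S v⁻¹ : ℝ) ≤ wordLength S v := mod_cast wordLength_inv_le hS v
    linarith

theorem of_generators [N.Normal] (hS : Subgroup.closure S = ⊤) {φ : π →* π} {T : Set π}
    (h : ∀ s ∈ T, OrbitGrowthLE S φ N r s) (hx : x ∈ Subgroup.closure T) :
    OrbitGrowthLE S φ N r x := by
  induction hx using Subgroup.closure_induction with
  | mem s hs => exact h s hs
  | one => exact one φ
  | mul x y _ _ hx hy => exact hx.mul hS hy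
  | inv x _ hx => exact hx.inv hS

/-- Write `k = n * (k / n) + k % n` and apply the hypothesis to the finitely many starting points
`f^[i] x` with `i < n`. Dividing their constants by `r ^ i` also covers `r < 1`. -/
theorem of_iterate {f : π → π} {n : ℕ} (hn : 0 < n) (hr : 0 < r)
    (h : ∀ x, OrbitGrowthLE S f^[n] N (r ^ n) x) (x : π) : OrbitGrowthLE S f N r x := by
  choose C hC0 hC using fun x => (h x).exists_nonneg (pow_pos hr n)
  refine ⟨∑ i ∈ Finset.range n, C (f^[i] x) / r ^ i, fun k => ?_⟩
  obtain ⟨w, hw, hl⟩ := hC (f^[k % n] x) (k / n)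
  rw [← Function.iterate_mul, ← Function.iterate_add_apply, Nat.div_add_mod] at hw
  refine ⟨w, hw, hl.trans ?_⟩
  have h1 : C (f^[k % n] x) / r ^ (k % n) ≤ ∑ i ∈ Finset.range n, C (f^[i] x) / r ^ i :=
    Finset.single_le_sum (f := fun i => C (f^[i] x) / r ^ i)
      (fun i _ => div_nonneg (hC0 _) (by positivity)) (Finset.mem_range.2 (Nat.mod_lt k hn))
  have h2 : C (f^[k % n] x) * (r ^ n) ^ (k / n) = C (f^[k % n] x) / r ^ (k % n) * r ^ k := by
    have h3 : r ^ k = (r ^ n) ^ (k / n) * r ^ (k % n) := by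
      rw [← pow_mul, ← pow_add, Nat.div_add_mod]
    rw [h3]
    field_simp
  rw [h2]
  exact mul_le_mul_of_nonneg_right h1 (by positivity)

/-- Only the first `n` points of the orbit can be nontrivial, so every positive rate is allowed,
including rates below `1`. -/
theorem of_iterate_eq_one {φ : π →* π} {n : ℕ} (hr : 0 < r) (h : φ^[n] x = 1) :
    OrbitGrowthLE S φ N r x := by
  refine ⟨∑ i ∈ Finset.range n, wordLength S (φ^[i] x) / r ^ i, fun k => ⟨φ^[k] x, by simp, ?_⟩⟩
  rcases lt_or_ge k n with hk | hk
  · rw [← div_le_iff₀ (by positivity)]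
    exact Finset.single_le_sum (f := fun i => (wordLength S (φ^[i] x) : ℝ) / r ^ i)
      (fun i _ => by positivity) (Finset.mem_range.2 hk)
  · obtain ⟨j, rfl⟩ := Nat.exists_eq_add_of_le' hk
    rw [Function.iterate_add_apply, h, iterate_map_one]
    simp only [wordLength_one, Nat.cast_zero]
    exact mul_nonneg (Finset.sum_nonneg fun i _ => by positivity) (by positivity)

theorem wordLength_le {f : π → π} (h : OrbitGrowthLE S f ⊥ r x) :
    ∃ C : ℝ, ∀ k : ℕ, (wordLength S (f^[k] x) : ℝ) ≤ C * r ^ k := by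
  obtain ⟨C, hC⟩ := h
  refine ⟨C, fun k => ?_⟩
  obtain ⟨w, hw, hl⟩ := hC k
  rw [Subgroup.mem_bot, inv_mul_eq_one] at hw
  rwa [← hw]

end OrbitGrowthLE

/-! ### Growth rate and orbit bounds. -/

section GrowthRate

variable {π : Type*} [Group π] {S : Set π}

theorem eventually_mul_pow_le_pow {a b : ℝ} (ha : 0 ≤ a) (hab : a < b) (C : ℝ) :
    ∀ᶠ k : ℕ in atTop, C * a ^ k ≤ b ^ k := by
  have hb : 0 < b := ha.trans_lt hab
  have h : Tendsto (fun k : ℕ => C * (a / b) ^ k) atTop (nhds (C * 0)) :=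
    (tendsto_pow_atTop_nhds_zero_of_lt_one (by positivity) ((div_lt_one hb).2 hab)).const_mul C
  rw [mul_zero] at h
  filter_upwards [h.eventually (gt_mem_nhds zero_lt_one)] with k hk
  rw [div_pow, ← mul_div_assoc, div_lt_one (by positivity)] at hk
  exact hk.le

/-- The constant in an orbit bound disappears in the limit: with `q` strictly between `r₀` and `r`,
eventually `C * q ^ k ≤ r ^ k`. -/
theorem growthRate_le_ofReal {φ : π →* π} {r₀ : ℝ} (h0 : 0 ≤ r₀)
    (h : ∀ r > r₀, ∀ x, OrbitGrowthLE S φ ⊥ r x) : growthRate S φ ≤ ENNReal.ofReal r₀ := by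
  refine iSup_le fun x => ?_
  refine le_of_forall_gt_imp_ge_of_dense fun a ha => ?_
  obtain ⟨b, hb, hba⟩ := exists_between ha
  have hbtop : b ≠ ⊤ := hba.ne_top
  obtain ⟨r, rfl⟩ : ∃ r : ℝ, b = ENNReal.ofReal r := ⟨b.toReal, (ENNReal.ofReal_toReal hbtop).symm⟩
  have hr : r₀ < r := (ENNReal.ofReal_lt_ofReal_iff_of_nonneg h0).1 hb
  obtain ⟨q, hq, hqr⟩ := exists_between hr
  obtain ⟨C, hC⟩ := (h q hq x).wordLength_le
  have hr0 : 0 < r := h0.trans_lt hr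
  refine (Filter.limsup_le_of_le ?_ ?_).trans hba.le
  · isBoundedDefault
  · filter_upwards [eventually_mul_pow_le_pow (h0.trans hq.le) hqr C, eventually_gt_atTop 0]
      with k hk hk0
    rw [one_div, ENNReal.rpow_inv_le_iff (by positivity), ENNReal.rpow_natCast,
      ← ENNReal.ofReal_pow hr0.le, ← ENNReal.ofReal_natCast]
    exact ENNReal.ofReal_le_ofReal ((hC k).trans hk)

theorem eventually_wordLength_le_of_growthRate_lt {φ : π →* π} {r : ℝ}
    (h : growthRate S φ < ENNReal.ofReal r) (x : π) :
    ∀ᶠ k : ℕ in atTop, (wordLength S (φ^[k] x) : ℝ) ≤ r ^ k := by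
  have hr : 0 < r := ENNReal.ofReal_pos.1 (bot_le.trans_lt h)
  have hx := (le_iSup (fun γ : π => limsup (fun k : ℕ =>
    (wordLength S (φ^[k] γ) : ℝ≥0∞) ^ (1 / (k : ℝ))) atTop) x).trans_lt h
  filter_upwards [Filter.eventually_lt_of_limsup_lt hx, eventually_gt_atTop 0] with k hk hk0
  have h1 := hk.le
  rw [one_div, ENNReal.rpow_inv_le_iff (by positivity), ENNReal.rpow_natCast,
    ← ENNReal.ofReal_pow hr.le, ← ENNReal.ofReal_natCast] at h1
  exact (ENNReal.ofReal_le_ofReal_iff (by positivity)).1 h1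

end GrowthRate

/-! ### Descent along the lower central series. -/

section Nilpotent

variable {π : Type*} [Group π] {S : Set π}

theorem mk_commute_of_mem_lowerCentralSeries {i : ℕ} {x : π}
    (hx : x ∈ (⊤ : Subgroup π).lowerCentralSeries i) (y : π) :
    Commute (x : π ⧸ (⊤ : Subgroup π).lowerCentralSeries (i + 1)) y := by
  rw [← commutatorElement_eq_one_iff_commute]
  exact (QuotientGroup.eq_one_iff ⁅x, y⁆).2
    (Subgroup.commutator_mem_commutator hx (Subgroup.mem_top y))

theorem map_mem_lowerCentralSeries (φ : π →* π) {i : ℕ} {x : π}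
    (hx : x ∈ (⊤ : Subgroup π).lowerCentralSeries i) :
    φ x ∈ (⊤ : Subgroup π).lowerCentralSeries i := by
  have h : ((⊤ : Subgroup π).lowerCentralSeries i).map φ ≤
      (⊤ : Subgroup π).lowerCentralSeries i := by
    clear hx
    induction i with
    | zero => exact le_top
    | succ i ih =>
      rw [Subgroup.lowerCentralSeries_succ, Subgroup.map_commutator]
      exact Subgroup.commutator_mono ih le_top
  exact h (Subgroup.mem_map_of_mem φ hx)

theorem QuotientGroup.mk_commutatorElement (N : Subgroup π) [N.Normal] (x y : π) :
    ((⁅x, y⁆ : π) : π ⧸ N) = ⁅(x : π ⧸ N), (y : π ⧸ N)⁆ :=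
  map_commutatorElement (QuotientGroup.mk' N) x y

theorem commutatorElement_pow_left {G : Type*} [Group G] {x y : G} (h : Commute ⁅x, y⁆ x) (m : ℕ) :
    ⁅x ^ m, y⁆ = ⁅x, y⁆ ^ m := by
  induction m with
  | zero => simp
  | succ m ih =>
    have h1 : ⁅x ^ (m + 1), y⁆ = x * ⁅x ^ m, y⁆ * x⁻¹ * ⁅x, y⁆ := by
      simp only [commutatorElement_def, pow_succ']
      group
    rw [h1, ih, ((h.pow_left m).symm).eq, mul_inv_cancel_right, pow_succ]

theorem commutatorElement_mul_mul {G : Type*} [Group G] {x y a b : G} (ha : ∀ g, Commute a g)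
    (hb : ∀ g, Commute b g) : ⁅x * a, y * b⁆ = ⁅x, y⁆ := by
  simp only [commutatorElement_def, mul_inv_rev]
  have h1 : x * a * (y * b) * (a⁻¹ * x⁻¹) * (b⁻¹ * y⁻¹) =
      x * (a * (y * b * a⁻¹)) * x⁻¹ * b⁻¹ * y⁻¹ := by group
  rw [h1, (ha _).eq, inv_mul_cancel_right]
  have h2 : x * (y * b) * x⁻¹ * b⁻¹ * y⁻¹ = x * y * (b * x⁻¹) * b⁻¹ * y⁻¹ := by group
  rw [h2, (hb _).eq]
  group

/-- If an endomorphism of a group maps every element into the isolator of the commutator subgroup,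
then it moves the isolators of the lower central series down. -/
theorem exists_pow_mem_lowerCentralSeries_succ {ψ : π →* π}
    (hψ : ∀ x, ∃ m : ℕ, 0 < m ∧ ψ x ^ m ∈ commutator π) (i : ℕ) :
    ∀ x ∈ (⊤ : Subgroup π).lowerCentralSeries i,
      ∃ m : ℕ, 0 < m ∧ ψ x ^ m ∈ (⊤ : Subgroup π).lowerCentralSeries (i + 1) := by
  induction i with
  | zero => exact fun x _ => hψ x
  | succ i ih =>
    intro x hx
    have hx' : x ∈ Subgroup.closure {g | ∃ y ∈ (⊤ : Subgroup π).lowerCentralSeries i,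
      ∃ h ∈ (⊤ : Subgroup π), ⁅y, h⁆ = g} := hx
    simp only [← QuotientGroup.eq_one_iff, QuotientGroup.mk_pow]
    induction hx' using Subgroup.closure_induction with
    | mem g hg =>
      obtain ⟨y, hy, h, -, rfl⟩ := hg
      obtain ⟨m, hm, hym⟩ := ih y hy
      refine ⟨m, hm, ?_⟩
      -- Modulo the next term `⁅ψ y, ψ h⁆` is central, so its `m`-th power is `⁅ψ y ^ m, ψ h⁆`. This
      -- is trivial there because `ψ y ^ m` already lies one term further down.
      have h1 := mk_commute_of_mem_lowerCentralSeries
        (map_mem_lowerCentralSeries ψ hx) (ψ y)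
      rw [map_commutatorElement] at h1 ⊢
      rw [QuotientGroup.mk_commutatorElement] at h1 ⊢
      rw [← commutatorElement_pow_left h1, commutatorElement_eq_one_iff_commute]
      exact mk_commute_of_mem_lowerCentralSeries hym _
    | one => exact ⟨1, one_pos, by simp only [map_one, QuotientGroup.mk_one, one_pow]⟩
    | mul a b ha hb iha ihb =>
      obtain ⟨m, hm, h1⟩ := iha ha
      obtain ⟨n, hn, h2⟩ := ihb hb
      refine ⟨m * n, Nat.mul_pos hm hn, ?_⟩
      rw [map_mul, QuotientGroup.mk_mul,
        (mk_commute_of_mem_lowerCentralSeries (map_mem_lowerCentralSeries ψ ha) _).mul_pow,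
        pow_mul, h1, mul_comm m, pow_mul, h2, one_pow, one_pow, one_mul]
    | inv a ha iha =>
      obtain ⟨m, hm, h1⟩ := iha ha
      exact ⟨m, hm, by rw [map_inv, QuotientGroup.mk_inv, inv_pow, h1, inv_one]⟩

/-- Each application of `ψ` moves elements one step down the isolators of the lower central series.
After as many steps as the nilpotency class the image is torsion, hence trivial. -/
theorem exists_iterate_eq_one [Group.IsNilpotent π] (htf : ∀ x : π, IsOfFinOrder x → x = 1)
    {ψ : π →* π} (hψ : ∀ x, ∃ m : ℕ, 0 < m ∧ ψ x ^ m ∈ commutator π) :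
    ∃ n : ℕ, ∀ x, ψ^[n] x = 1 := by
  obtain ⟨n, hn⟩ := Subgroup.nilpotent_iff_lowerCentralSeries.1 ‹Group.IsNilpotent π›
  have key : ∀ i : ℕ, ∀ x : π, ∃ m : ℕ, 0 < m ∧
      ψ^[i] x ^ m ∈ (⊤ : Subgroup π).lowerCentralSeries i := by
    intro i x
    induction i with
    | zero => exact ⟨1, one_pos, Subgroup.mem_top _⟩
    | succ i ih =>
      obtain ⟨m, hm, h⟩ := ih
      obtain ⟨l, hl, h'⟩ := exists_pow_mem_lowerCentralSeries_succ hψ i _ h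
      refine ⟨m * l, Nat.mul_pos hm hl, ?_⟩
      rwa [Function.iterate_succ_apply', pow_mul, ← map_pow]
  refine ⟨n, fun x => htf _ ?_⟩
  obtain ⟨m, hm, h⟩ := key n x
  rw [hn, Subgroup.mem_bot] at h
  exact isOfFinOrder_iff_pow_eq_one.2 ⟨m, hm, h⟩

namespace OrbitGrowthLE

/-- It suffices to treat generators `⁅x, y⁆`. If `v`, `w` are short representatives of `φ^[k] x`,
`φ^[k] y`, then `⁅v, w⁆` represents `φ^[k] ⁅x, y⁆`, since the errors are central modulo the next
term; its length is linear in those of `v` and `w`. -/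
theorem of_mem_lowerCentralSeries (hS : Subgroup.closure S = ⊤) {φ : π →* π} {r : ℝ} {i : ℕ}
    (h : ∀ x, OrbitGrowthLE S φ ((⊤ : Subgroup π).lowerCentralSeries (i + 1)) r x) {z : π}
    (hz : z ∈ (⊤ : Subgroup π).lowerCentralSeries (i + 1)) :
    OrbitGrowthLE S φ ((⊤ : Subgroup π).lowerCentralSeries (i + 2)) r z := by
  refine of_generators hS (T := {g | ∃ y ∈ (⊤ : Subgroup π).lowerCentralSeries i,
      ∃ h ∈ (⊤ : Subgroup π), ⁅y, h⁆ = g}) ?_ hz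
  rintro _ ⟨x, -, y, -, rfl⟩
  obtain ⟨C, hC⟩ := h x
  obtain ⟨D, hD⟩ := h y
  refine ⟨2 * (C + D), fun k => ?_⟩
  obtain ⟨v, hv, hvl⟩ := hC k
  obtain ⟨w, hw, hwl⟩ := hD k
  refine ⟨⁅v, w⁆, ?_, ?_⟩
  · have hk : φ^[k] ⁅x, y⁆ = ⁅φ^[k] x, φ^[k] y⁆ := by
      simp only [commutatorElement_def, iterate_map_mul, iterate_map_inv]
    rw [← QuotientGroup.eq, hk, QuotientGroup.mk_commutatorElement,
      QuotientGroup.mk_commutatorElement, ← mul_inv_cancel_left v (φ^[k] x),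
      ← mul_inv_cancel_left w (φ^[k] y), QuotientGroup.mk_mul _ v, QuotientGroup.mk_mul _ w]
    refine (commutatorElement_mul_mul (fun g => ?_) fun g => ?_).symm
    all_goals
      induction g using QuotientGroup.induction_on
      exact mk_commute_of_mem_lowerCentralSeries (by assumption) _
  · have : (wordLength S ⁅v, w⁆ : ℝ) ≤ 2 * (wordLength S v + wordLength S w) :=
      mod_cast wordLength_commutator_le hS v w
    linarith

/-- If orbits grow at most like `r ^ k` for all `r > r₀` both modulo `M ≥ N` and for elements of
`M` modulo `N`, then they do so modulo `N`. -/
theorem of_extension (hS : Subgroup.closure S = ⊤) (hSf : S.Finite) {φ : π →* π} {r₀ : ℝ}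
    (h0 : 0 ≤ r₀) {M N : Subgroup π} [N.Normal]
    (hM : ∀ r > r₀, ∀ x, OrbitGrowthLE S φ M r x)
    (hN : ∀ r > r₀, ∀ z ∈ M, OrbitGrowthLE S φ N r z) :
    ∀ r > r₀, ∀ x, OrbitGrowthLE S φ N r x := by
  intro μ hμ
  obtain ⟨ν, hν, hνμ⟩ := exists_between hμ
  have hν0 : 0 < ν := h0.trans_lt hν
  have hμ0 : 0 < μ := hν0.trans hνμ
  choose C hC0 hC using fun x => (hM ν hν x).exists_nonneg hν0
  -- One `n` serves all generators: each `φ^[n] s` is `w s` times an element of `M`, with length of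
  -- `w s` at most `μ ^ n`. The absence of a constant factor is what allows this to be iterated.
  obtain ⟨n, hn, hn0⟩ := ((eventually_mul_pow_le_pow hν0.le hνμ
    (∑ s ∈ hSf.toFinset, C s)).and (eventually_gt_atTop 0)).exists
  have hstep : ∀ s ∈ S, ∃ w, w⁻¹ * φ^[n] s ∈ M ∧ (wordLength S w : ℝ) ≤ μ ^ n := by
    intro s hs
    obtain ⟨w, hw, hl⟩ := hC s n
    refine ⟨w, hw, hl.trans (le_trans ?_ hn)⟩
    refine mul_le_mul_of_nonneg_right ?_ (by positivity)
    exact Finset.single_le_sum (f := C) (fun i _ => hC0 i) (hSf.mem_toFinset.2 hs)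
  choose! w hwM hwl using hstep
  have hz : ∀ s ∈ S, ∃ D : ℝ, 0 ≤ D ∧ ∀ k, ∃ v, v⁻¹ * φ^[k] ((w s)⁻¹ * φ^[n] s) ∈ N ∧
      (wordLength S v : ℝ) ≤ D * ν ^ k :=
    fun s hs => (hN ν hν _ (hwM s hs)).exists_nonneg hν0
  choose! D hD0 hD using hz
  obtain ⟨B, hB0, hB⟩ : ∃ B : ℝ, 0 ≤ B ∧ ∀ s ∈ S, D s ≤ B :=
    ⟨∑ s ∈ hSf.toFinset, D s, Finset.sum_nonneg fun s hs => hD0 s (hSf.mem_toFinset.1 hs),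
      fun s hs => Finset.single_le_sum (f := D) (fun i hi => hD0 i (hSf.mem_toFinset.1 hi))
        (hSf.mem_toFinset.2 hs)⟩
  have hpow : ν ^ n < μ ^ n := pow_lt_pow_left₀ hνμ hν0.le hn0.ne'
  -- Lengths of representatives of `φ^[n * m] s` obey `ℓ (m + 1) ≤ μ ^ n * ℓ m + B * ν ^ (n * m)`,
  -- where the last term comes from the `M`-part. With `ℓ 0 = 1`, the equality case is solved by `(1
  -- + d) * μ ^ (n * m) - d * ν ^ (n * m)`.
  set d : ℝ := B / (μ ^ n - ν ^ n) with hd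
  have hd0 : 0 ≤ d := div_nonneg hB0 (sub_nonneg.2 hpow.le)
  have hdB : d * (μ ^ n - ν ^ n) = B := div_mul_cancel₀ _ (sub_pos.2 hpow).ne'
  have hprop : ∀ (m : ℕ) (b : ℝ), (∀ s ∈ S, ∃ v, v⁻¹ * φ^[m] s ∈ N ∧ (wordLength S v : ℝ) ≤ b) →
      ∀ x, ∃ v, v⁻¹ * φ^[m] x ∈ N ∧ (wordLength S v : ℝ) ≤ b * wordLength S x := by
    intro m b hb x
    obtain ⟨l, hl, hlS, rfl⟩ := exists_word_of_closure_eq_top hS x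
    rw [← hl]
    clear hl
    induction l with
    | nil => exact ⟨1, by simp [iterate_map_one], by simp⟩
    | cons a l ih =>
      obtain ⟨v, hv, hvl⟩ := ih fun x hx => hlS x (List.mem_cons_of_mem _ hx)
      obtain ⟨u, hu, hul⟩ : ∃ u, u⁻¹ * φ^[m] a ∈ N ∧ (wordLength S u : ℝ) ≤ b := by
        rcases hlS a (by simp) with h | h
        · exact hb a h
        · obtain ⟨u, hu, hul⟩ := hb _ h
          refine ⟨u⁻¹, ?_, le_trans (mod_cast wordLength_inv_le hS u) hul⟩
          rw [← QuotientGroup.eq] at hu ⊢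
          rw [QuotientGroup.mk_inv, hu, iterate_map_inv, QuotientGroup.mk_inv, inv_inv]
      refine ⟨u * v, ?_, ?_⟩
      · rw [← QuotientGroup.eq] at hu hv ⊢
        rw [List.prod_cons, iterate_map_mul, QuotientGroup.mk_mul, QuotientGroup.mk_mul, hu, hv]
      · have : (wordLength S (u * v) : ℝ) ≤ wordLength S u + wordLength S v :=
          mod_cast wordLength_mul_le hS u v
        rw [List.length_cons]
        push_cast
        linarith
  have hrec : ∀ m : ℕ, ∀ s ∈ S, ∃ v, v⁻¹ * φ^[n * m] s ∈ N ∧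
      (wordLength S v : ℝ) ≤ (1 + d) * μ ^ (n * m) - d * ν ^ (n * m) := by
    intro m
    induction m with
    | zero => exact fun s hs => ⟨s, by simp, by simpa using wordLength_le_one hs⟩
    | succ m ih =>
      intro s hs
      obtain ⟨u, hu, hul⟩ := hprop _ _ ih (w s)
      obtain ⟨v, hv, hvl⟩ := hD s hs (n * m)
      refine ⟨u * v, ?_, ?_⟩
      · rw [← QuotientGroup.eq] at hu hv ⊢
        rw [QuotientGroup.mk_mul, hu, hv, ← QuotientGroup.mk_mul, ← iterate_map_mul,
          mul_inv_cancel_left, Nat.mul_succ, Function.iterate_add_apply]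
      · have h1 : (wordLength S (u * v) : ℝ) ≤ wordLength S u + wordLength S v :=
          mod_cast wordLength_mul_le hS u v
        have h2 : ν ^ (n * m) ≤ μ ^ (n * m) := pow_le_pow_left₀ hν0.le hνμ.le _
        have h3 : 0 ≤ (1 + d) * μ ^ (n * m) - d * ν ^ (n * m) := by
          have : 0 < μ ^ (n * m) := by positivity
          nlinarith
        have h4 := mul_le_mul_of_nonneg_left (hwl s hs) h3
        have h5 : D s * ν ^ (n * m) ≤ B * ν ^ (n * m) :=
          mul_le_mul_of_nonneg_right (hB s hs) (by positivity)
        rw [Nat.mul_succ, pow_add, pow_add]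
        have h6 : (1 + d) * (μ ^ (n * m) * μ ^ n) - d * (ν ^ (n * m) * ν ^ n) =
            ((1 + d) * μ ^ (n * m) - d * ν ^ (n * m)) * μ ^ n +
              (d * (μ ^ n - ν ^ n)) * ν ^ (n * m) := by ring
        rw [h6, hdB]
        linarith
  refine of_iterate hn0 hμ0 fun x => ⟨(1 + d) * wordLength S x, fun m => ?_⟩
  obtain ⟨v, hv, hvl⟩ := hprop _ _ (hrec m) x
  rw [← Function.iterate_mul]
  refine ⟨v, hv, hvl.trans ?_⟩
  rw [← pow_mul, mul_right_comm]
  refine mul_le_mul_of_nonneg_right ?_ (by positivity)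
  have : 0 < ν ^ (n * m) := by positivity
  nlinarith

theorem of_commutator [Group.IsNilpotent π] (hS : Subgroup.closure S = ⊤) (hSf : S.Finite)
    {φ : π →* π} {r₀ : ℝ} (h0 : 0 ≤ r₀)
    (h : ∀ r > r₀, ∀ x, OrbitGrowthLE S φ (commutator π) r x) :
    ∀ r > r₀, ∀ x, OrbitGrowthLE S φ ⊥ r x := by
  obtain ⟨n, hn⟩ := Subgroup.nilpotent_iff_lowerCentralSeries.1 ‹Group.IsNilpotent π›
  have key : ∀ i : ℕ, ∀ r > r₀, ∀ x,
      OrbitGrowthLE S φ ((⊤ : Subgroup π).lowerCentralSeries (i + 1)) r x := by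
    intro i
    induction i with
    | zero => exact h
    | succ i ih =>
      exact of_extension hS hSf h0 ih fun r hr z hz => of_mem_lowerCentralSeries hS (ih r hr) hz
  -- The induction starts at the commutator subgroup, term `1` of the series; going one term past
  -- the vanishing term `n` also covers `n = 0`.
  have hbot : (⊤ : Subgroup π).lowerCentralSeries (n + 1) = ⊥ := by
    rw [Subgroup.lowerCentralSeries_succ, hn, Subgroup.commutator_bot_left]
  rw [← hbot]
  exact key n

end OrbitGrowthLE

end Nilpotent

/-! ### Largest eigenvalue and growth of matrix powers. -/

section MaxAbsRoot

open Polynomial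

theorem maxAbsRoot_nonneg {R : Type*} [CommRing R] [Algebra R ℂ] (p : R[X]) :
    0 ≤ maxAbsRoot p :=
  Real.sSup_nonneg (by rintro _ ⟨μ, -, rfl⟩; exact norm_nonneg μ)

theorem norm_le_maxAbsRoot {R : Type*} [CommRing R] [Algebra R ℂ] {p : R[X]} {μ : ℂ}
    (hμ : μ ∈ p.aroots ℂ) : ‖μ‖ ≤ maxAbsRoot p := by
  refine le_csSup (Set.Finite.bddAbove ?_) ⟨μ, hμ, rfl⟩
  exact ((p.aroots ℂ).toFinset.finite_toSet.image fun μ : ℂ => ‖μ‖).subset fun r hr => by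
    obtain ⟨ν, hν, rfl⟩ := hr
    exact ⟨ν, by simpa using hν, rfl⟩

theorem mem_aroots_charpoly_iff {n : Type*} [Fintype n] [DecidableEq n] {R : Type*} [CommRing R]
    [Algebra R ℂ] (M : Matrix n n R) (μ : ℂ) :
    μ ∈ M.charpoly.aroots ℂ ↔ μ ∈ spectrum ℂ (M.map (algebraMap R ℂ)) := by
  rw [Matrix.mem_spectrum_iff_isRoot_charpoly, aroots, Matrix.charpoly_map,
    mem_roots ((Matrix.charpoly_monic M).map _).ne_zero]

end MaxAbsRoot

section Matrix

attribute [local instance] Matrix.linftyOpNormedRing Matrix.linftyOpNormedAlgebra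

variable {n : Type*} [Fintype n] [DecidableEq n]

theorem Matrix.norm_apply_le_linftyOpNorm (A : Matrix n n ℂ) (i j : n) : ‖A i j‖ ≤ ‖A‖ := by
  rw [← coe_nnnorm, ← coe_nnnorm, NNReal.coe_le_coe, Matrix.linfty_opNNNorm_def]
  exact (Finset.single_le_sum (f := fun j => ‖A i j‖₊) (fun _ _ => zero_le)
    (Finset.mem_univ j)).trans
    (Finset.le_sup (f := fun i => ∑ j, ‖A i j‖₊) (Finset.mem_univ i))

theorem Matrix.linftyOpNorm_le_sum (A : Matrix n n ℂ) : ‖A‖ ≤ ∑ i, ∑ j, ‖A i j‖ := by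
  have h : ‖A‖₊ ≤ ∑ i, ∑ j, ‖A i j‖₊ := by
    rw [Matrix.linfty_opNNNorm_def]
    exact Finset.sup_le fun i hi =>
      Finset.single_le_sum (f := fun i => ∑ j, ‖A i j‖₊) (fun _ _ => zero_le) hi
  have h' := NNReal.coe_le_coe.2 h
  push_cast at h'
  exact h'

/-- By Gelfand's formula `‖a ^ k‖ ≤ r ^ k` from some exponent on; the finitely many earlier powers
go into the constant. -/
theorem exists_norm_pow_le_of_spectrum {A : Type*} [NormedRing A] [NormedAlgebra ℂ A]
    [CompleteSpace A] {a : A} {r₀ r : ℝ} (h0 : 0 ≤ r₀) (ha : ∀ μ ∈ spectrum ℂ a, ‖μ‖ ≤ r₀)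
    (hr : r₀ < r) : ∃ C : ℝ, ∀ k : ℕ, ‖a ^ k‖ ≤ C * r ^ k := by
  have hr0 : 0 < r := h0.trans_lt hr
  have hrad : spectralRadius ℂ a < ENNReal.ofReal r := by
    refine lt_of_le_of_lt (iSup₂_le fun μ hμ => ?_)
      ((ENNReal.ofReal_lt_ofReal_iff_of_nonneg h0).2 hr)
    rw [← enorm_eq_nnnorm, ← ofReal_norm]
    exact ENNReal.ofReal_le_ofReal (ha μ hμ)
  have hev := (spectrum.pow_nnnorm_pow_one_div_tendsto_nhds_spectralRadius a).eventually_lt_const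
    hrad
  obtain ⟨K, hK⟩ := eventually_atTop.1 (hev.and (eventually_gt_atTop 0))
  have hsum : ∀ i, 0 ≤ ‖a ^ i‖ / r ^ i := fun i => by positivity
  refine ⟨1 + ∑ i ∈ Finset.range K, ‖a ^ i‖ / r ^ i, fun k => ?_⟩
  rw [← div_le_iff₀ (by positivity)]
  rcases lt_or_ge k K with hk | hk
  · have := Finset.single_le_sum (f := fun i => ‖a ^ i‖ / r ^ i) (fun i _ => hsum i)
      (Finset.mem_range.2 hk)
    linarith
  · obtain ⟨h1, h2⟩ := hK k hk
    have h3 := h1.le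
    rw [one_div, ENNReal.rpow_inv_le_iff (by positivity), ENNReal.rpow_natCast,
      ← ENNReal.ofReal_pow hr0.le, ← enorm_eq_nnnorm, ← ofReal_norm,
      ENNReal.ofReal_le_ofReal_iff (by positivity)] at h3
    have h4 : ‖a ^ k‖ / r ^ k ≤ 1 := (div_le_one (by positivity)).2 h3
    linarith [Finset.sum_nonneg fun i (_ : i ∈ Finset.range K) => hsum i]

theorem Matrix.exists_norm_pow_apply_le {R : Type*} [CommRing R] [Algebra R ℂ] {M : Matrix n n R}
    {r : ℝ} (hr : maxAbsRoot M.charpoly < r) :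
    ∃ C : ℝ, ∀ (k : ℕ) (i j : n), ‖algebraMap R ℂ ((M ^ k) i j)‖ ≤ C * r ^ k := by
  obtain ⟨C, hC⟩ := exists_norm_pow_le_of_spectrum (a := M.map (algebraMap R ℂ))
    (maxAbsRoot_nonneg _) (fun μ hμ => norm_le_maxAbsRoot ((mem_aroots_charpoly_iff M μ).2 hμ)) hr
  refine ⟨C, fun k i j => le_trans ?_ (hC k)⟩
  have h : (M.map (algebraMap R ℂ)) ^ k = (M ^ k).map (algebraMap R ℂ) :=
    (map_pow (algebraMap R ℂ).mapMatrix M k).symm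
  rw [h]
  exact Matrix.norm_apply_le_linftyOpNorm ((M ^ k).map (algebraMap R ℂ)) i j

/-- If `μ` is an eigenvalue, `μ ^ k` is one of `M ^ k`, so its modulus is at most a fixed multiple
of `r ^ k`; this fails for large `k` if `‖μ‖ > r`. -/
theorem Matrix.maxAbsRoot_charpoly_le {R : Type*} [CommRing R] [Algebra R ℂ] {M : Matrix n n R}
    {r : ℝ} (hr : 0 ≤ r) {C : ℝ}
    (h : ∀ᶠ k : ℕ in atTop, ∀ i j : n, ‖algebraMap R ℂ ((M ^ k) i j)‖ ≤ C * r ^ k) :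
    maxAbsRoot M.charpoly ≤ r := by
  refine Real.sSup_le ?_ hr
  rintro _ ⟨μ, hμ, rfl⟩
  by_contra! hlt
  obtain ⟨q, hrq, hqμ⟩ := exists_between hlt
  rw [mem_aroots_charpoly_iff] at hμ
  set N : ℝ := Fintype.card n * Fintype.card n * ‖(1 : Matrix n n ℂ)‖ with hN
  obtain ⟨k, hk, hk', hk0⟩ := (h.and ((eventually_mul_pow_le_pow hr hrq (N * C)).and
    (eventually_gt_atTop 0))).exists
  have h1 : (M.map (algebraMap R ℂ)) ^ k = (M ^ k).map (algebraMap R ℂ) :=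
    (map_pow (algebraMap R ℂ).mapMatrix M k).symm
  have h2 := spectrum.norm_le_norm_mul_of_mem (spectrum.pow_mem_pow _ k hμ)
  have h3 : ‖(M.map (algebraMap R ℂ)) ^ k‖ ≤ Fintype.card n * Fintype.card n * (C * r ^ k) := by
    rw [h1]
    refine (Matrix.linftyOpNorm_le_sum _).trans ?_
    refine (Finset.sum_le_sum fun i _ => Finset.sum_le_sum fun j _ => hk i j).trans ?_
    simp [mul_assoc]
  have h4 : ‖μ‖ ^ k ≤ N * C * r ^ k := by
    rw [← norm_pow]
    refine h2.trans ((mul_le_mul_of_nonneg_right h3 (norm_nonneg _)).trans (le_of_eq ?_))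
    rw [hN]
    ring
  exact absurd (h4.trans hk') (not_le.2 (pow_lt_pow_left₀ hqμ (hr.trans hrq.le) hk0.ne'))

/-- The spectral bound lives on complex matrices. Writing `T ^ k` as a combination of elementary
maps with the entries of the matrix power as coefficients brings it back to the real space. -/
theorem exists_norm_toContinuousLinearMap_pow_le {E : Type*} [NormedAddCommGroup E]
    [NormedSpace ℝ E] [FiniteDimensional ℝ E] {T : E →ₗ[ℝ] E} {r : ℝ} (hr : spLinear T < r) :
    ∃ C : ℝ, ∀ k : ℕ, ‖LinearMap.toContinuousLinearMap T ^ k‖ ≤ C * r ^ k := by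
  have hr0 : 0 < r := (maxAbsRoot_nonneg _).trans_lt hr
  set b := Module.finBasis ℝ E
  have hr' : maxAbsRoot (LinearMap.toMatrix b b T).charpoly < r := by
    rwa [LinearMap.charpoly_toMatrix]
  obtain ⟨C, hC⟩ := Matrix.exists_norm_pow_apply_le hr'
  set c : Fin (finrank ℝ E) → Fin (finrank ℝ E) → (E →L[ℝ] E) := fun i j =>
    LinearMap.toContinuousLinearMap (Matrix.toLin b b (Matrix.single i j 1))
  refine ⟨∑ i, ∑ j, C * ‖c i j‖, fun k => ?_⟩
  have h1 : LinearMap.toContinuousLinearMap T ^ k =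
      ∑ i, ∑ j, (LinearMap.toMatrix b b T ^ k) i j • c i j := by
    have h2 : LinearMap.toContinuousLinearMap T ^ k = LinearMap.toContinuousLinearMap (T ^ k) := by
      ext v
      rw [FunLike.coe_pow_eq_iterate, LinearMap.coe_toContinuousLinearMap',
        LinearMap.coe_toContinuousLinearMap', Module.End.coe_pow]
    have h3 : T ^ k = Matrix.toLin b b (LinearMap.toMatrix b b T ^ k) := by
      rw [LinearMap.toMatrix_pow, Matrix.toLin_toMatrix]
    rw [h2, h3]
    conv_lhs => rw [Matrix.matrix_eq_sum_single (LinearMap.toMatrix b b T ^ k)]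
    simp only [map_sum, c]
    refine Finset.sum_congr rfl fun i _ => Finset.sum_congr rfl fun j _ => ?_
    rw [← map_smul, ← map_smul, Matrix.smul_single, smul_eq_mul, mul_one]
  rw [h1, Finset.sum_mul]
  refine norm_sum_le_of_le _ fun i _ => ?_
  rw [Finset.sum_mul]
  refine norm_sum_le_of_le _ fun j _ => ?_
  rw [norm_smul, mul_right_comm]
  refine mul_le_mul_of_nonneg_right ?_ (norm_nonneg _)
  simpa using hC k i j

end Matrix

/-! ### The free abelian quotient and the equality with `sp(D₁)`. -/

section AbelianPart

variable {π : Type*} [Group π] {S : Set π} {k : ℕ}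

theorem toAdd_iterate_eq_mulVec {f : π →* Multiplicative (Fin k → ℤ)} {φ : π →* π}
    {D : Matrix (Fin k) (Fin k) ℤ} (h : ∀ x, (f (φ x)).toAdd = D.mulVec (f x).toAdd) (m : ℕ)
    (x : π) : (f (φ^[m] x)).toAdd = (D ^ m).mulVec (f x).toAdd := by
  induction m with
  | zero => simp
  | succ m ih => rw [Function.iterate_succ_apply', h, ih, Matrix.mulVec_mulVec, ← pow_succ']

/-- Column `j` of `D ^ m` is the image under `f` of the orbit of a lift of the `j`-th basis vector,
and `f` is Lipschitz. The homomorphism `f` is arbitrary so that the lemma also applies to the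
abelianization. -/
theorem ofReal_spMatrix_le_growthRate (hS : Subgroup.closure S = ⊤) (hSf : S.Finite) {φ : π →* π}
    {f : π →* Multiplicative (Fin k → ℤ)} (hf : Function.Surjective f)
    {D : Matrix (Fin k) (Fin k) ℤ} (h : ∀ x, (f (φ x)).toAdd = D.mulVec (f x).toAdd) :
    ENNReal.ofReal (spMatrix D) ≤ growthRate S φ := by
  by_contra! hlt
  obtain ⟨b, hb, hbs⟩ := exists_between hlt
  obtain ⟨r, rfl⟩ : ∃ r : ℝ, b = ENNReal.ofReal r :=
    ⟨b.toReal, (ENNReal.ofReal_toReal hbs.ne_top).symm⟩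
  have hr : 0 < r := ENNReal.ofReal_pos.1 (bot_le.trans_lt hb)
  refine absurd ?_ (not_le.2 ((ENNReal.ofReal_lt_ofReal_iff_of_nonneg hr.le).1 hbs))
  obtain ⟨C, hC0, hC⟩ : ∃ C : ℝ, 0 ≤ C ∧ ∀ s ∈ S, ‖(f s).toAdd‖ ≤ C :=
    ⟨∑ s ∈ hSf.toFinset, ‖(f s).toAdd‖, Finset.sum_nonneg fun _ _ => norm_nonneg _,
      fun s hs => Finset.single_le_sum (f := fun s => ‖(f s).toAdd‖) (fun _ _ => norm_nonneg _)
        (hSf.mem_toFinset.2 hs)⟩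
  have hlen : ∀ x, ‖(f x).toAdd‖ ≤ C * wordLength S x :=
    le_mul_wordLength hS (by simp) (fun x y => by rw [map_mul, toAdd_mul]; exact norm_add_le _ _)
      (fun x => by simp) hC
  choose x hx using fun j : Fin k => hf (Multiplicative.ofAdd (Pi.single j 1))
  have hev : ∀ᶠ m : ℕ in atTop, ∀ j, (wordLength S (φ^[m] (x j)) : ℝ) ≤ r ^ m :=
    eventually_all.2 fun j => eventually_wordLength_le_of_growthRate_lt hb (x j)
  refine Matrix.maxAbsRoot_charpoly_le hr.le (C := C) ?_
  filter_upwards [hev] with m hm i j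
  have h1 : (f (φ^[m] (x j))).toAdd i = (D ^ m) i j := by
    rw [toAdd_iterate_eq_mulVec h, hx, toAdd_ofAdd, Matrix.mulVec_single_one, Matrix.col_apply]
  have h2 : ‖(f (φ^[m] (x j))).toAdd i‖ ≤ ‖(f (φ^[m] (x j))).toAdd‖ := norm_le_pi_norm _ i
  rw [h1] at h2
  have h3 := mul_le_mul_of_nonneg_left (hm j) hC0
  have h4 : ‖algebraMap ℤ ℂ ((D ^ m) i j)‖ = ‖(D ^ m) i j‖ := by simp [Int.norm_eq_abs]
  rw [h4]
  exact h2.trans ((hlen _).trans h3)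

theorem finite_torsion_abelianization (hS : Subgroup.closure S = ⊤) (hSf : S.Finite) :
    Finite (CommGroup.torsion (Abelianization π)) := by
  have : Group.FG π := ⟨⟨hSf.toFinset, by simpa using hS⟩⟩
  have : Group.FG (Abelianization π) := inferInstanceAs (Group.FG (π ⧸ commutator π))
  have : Module.Finite ℤ (Additive (Abelianization π)) :=
    Module.Finite.iff_addGroup_fg.2 (AddGroup.fg_iff_mul_fg.2 (by simpa))
  have hfg : (CommGroup.torsion (Abelianization π)).FG := by
    have h : (AddSubgroup.toIntSubmodule (M := Additive (Abelianization π))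
        (Subgroup.toAddSubgroup (CommGroup.torsion (Abelianization π)))).FG :=
      IsNoetherian.noetherian _
    exact (Subgroup.fg_iff_add_fg _).2 ((Submodule.fg_iff_addSubgroup_fg _).1 h)
  have : Group.FG (CommGroup.torsion (Abelianization π)) := (Group.fg_iff_subgroup_fg _).2 hfg
  exact CommGroup.finite_of_fg_isMulTorsion _ CommMonoid.torsion.isMulTorsion

theorem OrbitGrowthLE.commutator_of_spMatrix_lt (hS : Subgroup.closure S = ⊤) (hSf : S.Finite)
    {φ : π →* π} {f : π →* Multiplicative (Fin k → ℤ)} (hf : Function.Surjective f)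
    (hker : f.ker = isolator π) {D : Matrix (Fin k) (Fin k) ℤ}
    (h : ∀ x, (f (φ x)).toAdd = D.mulVec (f x).toAdd) {r : ℝ} (hr : spMatrix D < r) (hr1 : 1 ≤ r)
    (x : π) : OrbitGrowthLE S φ (commutator π) r x := by
  have hr0 : 0 < r := by linarith
  obtain ⟨C, hC⟩ := Matrix.exists_norm_pow_apply_le hr
  choose s hs using fun j : Fin k => hf (Multiplicative.ofAdd (Pi.single j 1))
  have := finite_torsion_abelianization hS hSf
  choose lift hlift using fun a : CommGroup.torsion (Abelianization π) =>
    QuotientGroup.mk'_surjective (commutator π) a.1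
  obtain ⟨B, hB0, hB⟩ : ∃ B : ℝ, 0 ≤ B ∧ ∀ a, (wordLength S (lift a) : ℝ) ≤ B := by
    cases nonempty_fintype (CommGroup.torsion (Abelianization π))
    exact ⟨∑ a, (wordLength S (lift a) : ℝ), Finset.sum_nonneg fun _ _ => by positivity,
      fun a => Finset.single_le_sum (f := fun a => (wordLength S (lift a) : ℝ))
        (fun _ _ => by positivity) (Finset.mem_univ a)⟩
  refine ⟨∑ i, (∑ j, C * ‖(f x).toAdd j‖) * wordLength S (s i) + B, fun m => ?_⟩
  set n := (f (φ^[m] x)).toAdd with hn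
  -- `w` has the same image in `ℤᵏ` as `φ^[m] x`; modulo commutators they differ by one of finitely
  -- many torsion classes, corrected by `lift a`.
  set w := (List.ofFn fun i => s i ^ n i).prod with hw
  have hfw : f w = f (φ^[m] x) := by
    apply Multiplicative.toAdd.injective
    rw [← hn, hw, map_list_prod, List.map_ofFn, List.prod_ofFn, toAdd_prod]
    simp only [Function.comp_apply, map_zpow, hs, toAdd_zpow, toAdd_ofAdd]
    ext i
    simp [Finset.sum_apply, Pi.single_apply]
  have ht : w⁻¹ * φ^[m] x ∈ isolator π := by
    rw [← hker, MonoidHom.mem_ker, map_mul, map_inv, hfw, inv_mul_cancel]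
  set a : CommGroup.torsion (Abelianization π) := ⟨Abelianization.of (w⁻¹ * φ^[m] x), ht⟩
  refine ⟨w * lift a, ?_, ?_⟩
  · have h1 : Abelianization.of (lift a) = Abelianization.of (w⁻¹ * φ^[m] x) := hlift a
    rw [← Abelianization.ker_of, MonoidHom.mem_ker, map_mul, map_inv, map_mul, h1, map_mul, map_inv]
    group
  · have h1 : wordLength S w ≤ ∑ i, (n i).natAbs * wordLength S (s i) := by
      refine (wordLength_list_prod_le hS _).trans ?_
      rw [List.map_ofFn, List.sum_ofFn]
      exact Finset.sum_le_sum fun i _ => wordLength_zpow_le hS _ _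
    have h2 : (wordLength S (w * lift a) : ℝ) ≤
        (∑ i, (n i).natAbs * wordLength S (s i) : ℕ) + B := by
      have h3 : (wordLength S (w * lift a) : ℝ) ≤ wordLength S w + wordLength S (lift a) :=
        mod_cast wordLength_mul_le hS w (lift a)
      have h4 : (wordLength S w : ℝ) ≤ (∑ i, (n i).natAbs * wordLength S (s i) : ℕ) :=
        mod_cast h1
      linarith [hB a]
    refine h2.trans ?_
    rw [add_mul]
    -- Here `1 ≤ r` matters: the torsion correction is bounded but need not decay.
    refine add_le_add ?_ (le_mul_of_one_le_right hB0 (one_le_pow₀ hr1))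
    push_cast
    rw [Finset.sum_mul]
    refine Finset.sum_le_sum fun i _ => ?_
    rw [mul_right_comm]
    refine mul_le_mul_of_nonneg_right ?_ (by positivity)
    rw [← NNReal.coe_natCast, NNReal.natCast_natAbs, coe_nnnorm, hn,
      toAdd_iterate_eq_mulVec h, Matrix.mulVec, dotProduct, Finset.sum_mul]
    refine norm_sum_le_of_le _ fun j _ => ?_
    have h6 := hC m i j
    have h7 : ‖algebraMap ℤ ℂ ((D ^ m) i j)‖ = ‖(D ^ m) i j‖ := by simp [Int.norm_eq_abs]
    rw [h7] at h6
    have h8 := mul_le_mul_of_nonneg_left h6 (norm_nonneg ((f x).toAdd j))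
    rw [norm_mul]
    linarith

/-- The entries of `D ^ n` tend to `0` and are integers. -/
theorem exists_pow_eq_zero_of_spMatrix_lt_one {D : Matrix (Fin k) (Fin k) ℤ} (h : spMatrix D < 1) :
    ∃ n : ℕ, D ^ n = 0 := by
  obtain ⟨r, hr, hr1⟩ := exists_between h
  obtain ⟨C, hC⟩ := Matrix.exists_norm_pow_apply_le hr
  have hr0 : 0 ≤ r := (maxAbsRoot_nonneg _).trans hr.le
  obtain ⟨q, hq, hq1⟩ := exists_between hr1
  obtain ⟨n, hn, hn0⟩ := ((eventually_mul_pow_le_pow hr0 hq C).and (eventually_gt_atTop 0)).exists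
  refine ⟨n, ?_⟩
  ext i j
  have h1 := (hC n i j).trans hn
  have h2 : ‖algebraMap ℤ ℂ ((D ^ n) i j)‖ = ((|(D ^ n) i j| : ℤ) : ℝ) := by simp
  rw [h2] at h1
  have h3 : ((|(D ^ n) i j| : ℤ) : ℝ) < (1 : ℤ) := by
    rw [Int.cast_one]
    exact h1.trans_lt (pow_lt_one₀ (hr0.trans hq.le) hq1 hn0.ne')
  simpa using Int.abs_lt_one_iff.1 (Int.cast_lt.1 h3)

/-- The torsion of the abelianization prevents rates below `1` from being handled there. When `sp(D)
< 1`, an iterate of `φ` maps `π` into the isolator, and a further iterate is trivial because `π` is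
nilpotent and torsion-free. -/
theorem OrbitGrowthLE.of_spMatrix_lt [Group.IsNilpotent π]
    (htf : ∀ x : π, IsOfFinOrder x → x = 1) (hS : Subgroup.closure S = ⊤) (hSf : S.Finite)
    {φ : π →* π} {f : π →* Multiplicative (Fin k → ℤ)} (hf : Function.Surjective f)
    (hker : f.ker = isolator π) {D : Matrix (Fin k) (Fin k) ℤ}
    (h : ∀ x, (f (φ x)).toAdd = D.mulVec (f x).toAdd) :
    ∀ r > spMatrix D, ∀ x, OrbitGrowthLE S φ ⊥ r x := by
  rcases lt_or_ge (spMatrix D) 1 with hD | hD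
  · obtain ⟨n, hn⟩ := exists_pow_eq_zero_of_spMatrix_lt_one hD
    obtain ⟨ψ, hψn⟩ : ∃ ψ : π →* π, ⇑ψ = φ^[n] :=
      ⟨HPow.hPow (α := Monoid.End π) φ n, Monoid.End.coe_pow π φ n⟩
    obtain ⟨N, hN⟩ := exists_iterate_eq_one htf (ψ := ψ) fun x => by
      have hx : ψ x ∈ isolator π := by
        rw [← hker, MonoidHom.mem_ker]
        apply Multiplicative.toAdd.injective
        rw [hψn, toAdd_iterate_eq_mulVec h, hn, Matrix.zero_mulVec, toAdd_one]
      exact (mem_isolator_iff _).1 hx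
    intro r hr x
    refine of_iterate_eq_one (n := n * N) ((maxAbsRoot_nonneg _).trans_lt hr) ?_
    rw [Function.iterate_mul, ← hψn]
    exact hN x
  · exact of_commutator hS hSf (maxAbsRoot_nonneg _) fun r hr x =>
      commutator_of_spMatrix_lt hS hSf hf hker h hr (hD.trans hr.le) x

/-- The projection of `π` to `ℤᵏ` determined by coordinates on `π / √[π,π]`. -/
def freeProjection (e : π ⧸ isolator π ≃* Multiplicative (Fin k → ℤ)) :
    π →* Multiplicative (Fin k → ℤ) :=
  e.toMonoidHom.comp (QuotientGroup.mk' (isolator π))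

theorem freeProjection_apply (e : π ⧸ isolator π ≃* Multiplicative (Fin k → ℤ)) (x : π) :
    freeProjection e x = e x := rfl

theorem freeProjection_surjective (e : π ⧸ isolator π ≃* Multiplicative (Fin k → ℤ)) :
    Function.Surjective (freeProjection e) :=
  e.surjective.comp (QuotientGroup.mk'_surjective _)

theorem ker_freeProjection (e : π ⧸ isolator π ≃* Multiplicative (Fin k → ℤ)) :
    (freeProjection e).ker = isolator π := by
  ext x
  rw [MonoidHom.mem_ker, freeProjection_apply, EmbeddingLike.map_eq_one_iff,
    QuotientGroup.eq_one_iff]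

theorem Represents.freeProjection_apply {φ : π →* π}
    {e : π ⧸ isolator π ≃* Multiplicative (Fin k → ℤ)} {D : Matrix (Fin k) (Fin k) ℤ}
    (h : Represents φ e D) (x : π) :
    (freeProjection e (φ x)).toAdd = D.mulVec (freeProjection e x).toAdd :=
  h x

theorem exists_represents (e : π ⧸ isolator π ≃* Multiplicative (Fin k → ℤ)) (φ : π →* π) :
    ∃ D : Matrix (Fin k) (Fin k) ℤ, Represents φ e D := by
  set g : (Fin k → ℤ) →+ (Fin k → ℤ) :=
    AddMonoidHom.toMultiplicative.symm
      ((e.toMonoidHom.comp (inducedOnFree φ)).comp e.symm.toMonoidHom)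
    with hg
  refine ⟨LinearMap.toMatrix' g.toIntLinearMap, fun x => ?_⟩
  rw [LinearMap.toMatrix'_mulVec]
  simp [hg]

theorem exists_free_coordinates (hS : Subgroup.closure S = ⊤) (hSf : S.Finite) :
    ∃ k : ℕ, Nonempty (π ⧸ isolator π ≃* Multiplicative (Fin k → ℤ)) := by
  have : Group.FG π := ⟨⟨hSf.toFinset, by simpa using hS⟩⟩
  have : Group.FG (Abelianization π) := inferInstanceAs (Group.FG (π ⧸ commutator π))
  set A := Abelianization π ⧸ CommGroup.torsion (Abelianization π)
  have : Module.Finite ℤ (Additive A) :=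
    Module.Finite.iff_addGroup_fg.2 (AddGroup.fg_iff_mul_fg.2
      (by simpa using inferInstanceAs (Group.FG A)))
  have : IsMulTorsionFree A := inferInstance
  have : Module.IsTorsionFree ℤ (Additive A) := inferInstance
  have : Module.Free ℤ (Additive A) := inferInstance
  set b := (Module.finBasis ℤ (Additive A)).equivFun.toAddEquiv.toMultiplicative
  set f : π →* A := (QuotientGroup.mk' _).comp Abelianization.of
  have hf : Function.Surjective f :=
    (QuotientGroup.mk'_surjective _).comp (QuotientGroup.mk'_surjective _)
  have hker : f.ker = isolator π := by
    rw [← MonoidHom.comap_ker, QuotientGroup.ker_mk']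
    rfl
  exact ⟨_, ⟨(QuotientGroup.quotientMulEquivOfEq hker.symm).trans
    ((QuotientGroup.quotientKerEquivOfSurjective f hf).trans b)⟩⟩

end AbelianPart

/-! ### Word length in a cocompact lattice. -/

section Lattice

variable {π : Type*} [Group π] {S : Set π} {G : Type*} [Group G] [TopologicalSpace G]
  [IsTopologicalGroup G] {ι : π →* G}

theorem exists_isCompact_mul_range [LocallyCompactSpace G] [CompactSpace (G ⧸ ι.range)] :
    ∃ F : Set G, IsCompact F ∧ ∀ g, ∃ f ∈ F, ∃ γ, g = f * ι γ := by
  choose K hK hK1 using fun g : G => exists_compact_mem_nhds g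
  obtain ⟨t, -, ht⟩ := (isCompact_univ (X := G ⧸ ι.range)).elim_nhds_subcover
    (fun q => QuotientGroup.mk '' K q.out) (fun q _ => by
      have := QuotientGroup.isOpenMap_coe (N := ι.range) |>.image_mem_nhds (hK1 q.out)
      rwa [QuotientGroup.out_eq'] at this)
  refine ⟨⋃ q ∈ t, K q.out, t.isCompact_biUnion fun q _ => hK _, fun g => ?_⟩
  obtain ⟨q, hq, f, hf, hfg⟩ := Set.mem_iUnion₂.1 (ht (Set.mem_univ (g : G ⧸ ι.range)))
  obtain ⟨γ, hγ⟩ := QuotientGroup.eq.1 hfg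
  exact ⟨f, Set.mem_biUnion hq hf, γ, by rw [hγ, mul_inv_cancel_left]⟩

theorem finite_preimage_of_isCompact [T2Space G] [DiscreteTopology ι.range]
    (hι : Function.Injective ι) {P : Set G} (hP : IsCompact P) : {γ | ι γ ∈ P}.Finite := by
  have h1 : (P ∩ (ι.range : Set G)).Finite := by
    refine (hP.inter_right Subgroup.isClosed_of_discrete).finite ?_
    exact (isDiscrete_iff_discreteTopology.2 ‹_›).mono Set.inter_subset_right
  refine (h1.preimage hι.injOn).subset fun γ hγ => ⟨hγ, γ, rfl⟩

/-- The word length of a lattice element is bounded linearly by the number of factors in any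
expression of it as a product of elements of a fixed compact set. -/
theorem exists_wordLength_le_of_prod_eq [LocallyCompactSpace G] [T2Space G]
    [CompactSpace (G ⧸ ι.range)] [DiscreteTopology ι.range] (hι : Function.Injective ι)
    (hS : Subgroup.closure S = ⊤) {K : Set G} (hK : IsCompact K) :
    ∃ C : ℕ, ∀ (l : List G), (∀ x ∈ l, x ∈ K) → ∀ γ, ι γ = l.prod →
      wordLength S γ ≤ C * (l.length + 1) := by
  -- Milnor–Švarc argument: rewriting `x * f` as `f' * ι α` moves the factor in `F` leftwards past
  -- each factor `x`. Every `ι α` lies in the compact set `F⁻¹ * K * F`, which meets the lattice in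
  -- a finite set.
  obtain ⟨F, hF, hFG⟩ := exists_isCompact_mul_range (ι := ι)
  have hP1 := finite_preimage_of_isCompact hι ((hF.inv.mul hK).mul hF)
  have hP2 := finite_preimage_of_isCompact hι hF
  classical
  set C := ∑ β ∈ hP1.toFinset ∪ hP2.toFinset, wordLength S β
  obtain ⟨f₀, hf₀, β₀, h₀⟩ := hFG 1
  have hC1 : ∀ β, ι β ∈ F⁻¹ * K * F → wordLength S β ≤ C := fun β hβ =>
    Finset.single_le_sum (f := fun β => wordLength S β) (fun _ _ => Nat.zero_le _)
      (Finset.mem_union_left _ (hP1.mem_toFinset.2 hβ))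
  have hC2 : ∀ β, ι β ∈ F → wordLength S β ≤ C := fun β hβ =>
    Finset.single_le_sum (f := fun β => wordLength S β) (fun _ _ => Nat.zero_le _)
      (Finset.mem_union_right _ (hP2.mem_toFinset.2 hβ))
  refine ⟨C + wordLength S β₀ + C, fun l hl γ hγ => ?_⟩
  have key : ∀ l : List G, (∀ x ∈ l, x ∈ K) → ∃ f ∈ F, ∃ β, l.prod = f * ι β ∧
      wordLength S β ≤ C * l.length + wordLength S β₀ := by
    intro l hl
    induction l with
    | nil => exact ⟨f₀, hf₀, β₀, h₀, by simp⟩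
    | cons x l ih =>
      obtain ⟨f, hf, β, hβ, hβl⟩ := ih fun y hy => hl y (List.mem_cons_of_mem _ hy)
      obtain ⟨f', hf', α, hα⟩ := hFG (x * f)
      refine ⟨f', hf', α * β, ?_, ?_⟩
      · rw [List.prod_cons, hβ, ← mul_assoc, hα, map_mul, mul_assoc]
      · have h1 : wordLength S α ≤ C := by
          refine hC1 α ?_
          have : ι α = f'⁻¹ * x * f := by rw [mul_assoc, hα, inv_mul_cancel_left]
          rw [this]
          exact Set.mul_mem_mul (Set.mul_mem_mul (Set.inv_mem_inv.2 hf') (hl x (by simp))) hf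
        have h2 := wordLength_mul_le hS α β
        rw [List.length_cons, Nat.mul_succ]
        omega
  obtain ⟨f, hf, β, hβ, hβl⟩ := key l hl
  have h1 : ι (γ * β⁻¹) = f := by rw [map_mul, map_inv, hγ, hβ, mul_inv_cancel_right]
  have h2 : wordLength S (γ * β⁻¹) ≤ C := hC2 _ (by rwa [h1])
  have h3 := wordLength_mul_le hS (γ * β⁻¹) β
  rw [inv_mul_cancel_right] at h3
  have h4 : (C + wordLength S β₀ + C) * (l.length + 1) =
    C * l.length + wordLength S β₀ * l.length + C * l.length + (C + wordLength S β₀ + C) := by ring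
  have h5 : 0 ≤ wordLength S β₀ * l.length := Nat.zero_le _
  have h6 : 0 ≤ C * l.length := Nat.zero_le _
  omega

end Lattice

/-! ### Small elements of a connected Lie group. -/

section ChartAtOne

variable {E : Type*} [NormedAddCommGroup E]
  {G : Type*} [TopologicalSpace G] [ChartedSpace E G] [Group G]

/-- `g` lies within distance `δ` of `1` in the preferred chart at `1`. -/
def IsNearOne (E : Type*) [NormedAddCommGroup E] {G : Type*} [TopologicalSpace G]
    [ChartedSpace E G] [Group G] (δ : ℝ) (g : G) : Prop :=
  g ∈ (chartAt E (1 : G)).source ∧ ‖chartAt E (1 : G) g - chartAt E (1 : G) 1‖ ≤ δ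

theorem IsNearOne.mono {δ ε : ℝ} {g : G} (h : IsNearOne E δ g) (hδ : δ ≤ ε) : IsNearOne E ε g :=
  ⟨h.1, h.2.trans hδ⟩

theorem eventually_isNearOne {δ : ℝ} (hδ : 0 < δ) : ∀ᶠ g : G in nhds 1, IsNearOne E δ g := by
  have h1 := (chartAt E (1 : G)).open_source.mem_nhds (mem_chart_source E (1 : G))
  have h2 := ((chartAt E (1 : G)).continuousAt (mem_chart_source E (1 : G))).eventually
    (Metric.closedBall_mem_nhds _ hδ)
  filter_upwards [h1, h2] with g hg hg'
  exact ⟨hg, by rwa [← dist_eq_norm]⟩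

theorem exists_isNearOne_imp {p : E → Prop} (hp : ∀ᶠ u in nhds (chartAt E (1 : G) 1), p u) :
    ∃ δ > 0, ∀ g : G, IsNearOne E δ g → p (chartAt E (1 : G) g) := by
  obtain ⟨δ, hδ, h⟩ := Metric.eventually_nhds_iff.1 hp
  refine ⟨δ / 2, half_pos hδ, fun g hg => h ?_⟩
  rw [dist_eq_norm]
  linarith [hg.2]

theorem exists_isNearOne_imp_mem {U : Set G} (hU : U ∈ nhds (1 : G)) :
    ∃ δ > 0, ∀ g : G, IsNearOne E δ g → g ∈ U := by
  have h := (chartAt E (1 : G)).continuousAt_symm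
    ((chartAt E (1 : G)).map_source (mem_chart_source E (1 : G)))
  rw [ContinuousAt, (chartAt E (1 : G)).left_inv (mem_chart_source E (1 : G))] at h
  obtain ⟨δ, hδ, hδU⟩ := exists_isNearOne_imp (h.eventually hU)
  refine ⟨δ, hδ, fun g hg => ?_⟩
  have := hδU g hg
  rw [(chartAt E (1 : G)).left_inv hg.1] at this
  exact this

theorem prod_range_inv_mul {H : Type*} [Group H] (h : ℕ → H) (M : ℕ) :
    ((List.range M).map fun i => (h i)⁻¹ * h (i + 1)).prod = (h 0)⁻¹ * h M := by
  induction M with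
  | zero => simp
  | succ M ih => rw [List.range_succ, List.map_append, List.prod_append, ih]; simp [mul_assoc]

section LieGroup

variable [NormedSpace ℝ E] [LieGroup 𝓘(ℝ, E) ∞ G]

/-- In the chart, `(u, v) ↦ u⁻¹ v` is `C¹`, hence Lipschitz near the base point, and it is constant
on the diagonal; comparing `(u, v)` with `(u, u)` gives the bound. -/
theorem exists_isNearOne_inv_mul : ∃ K : ℝ, 0 ≤ K ∧ ∃ ρ > 0,
    Metric.ball (chartAt E (1 : G) 1) ρ ⊆ (chartAt E (1 : G)).target ∧
    ∀ u ∈ Metric.ball (chartAt E (1 : G) 1) ρ, ∀ v ∈ Metric.ball (chartAt E (1 : G) 1) ρ,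
      IsNearOne E (K * ‖v - u‖) (((chartAt E (1 : G)).symm u)⁻¹ * (chartAt E (1 : G)).symm v) := by
  have := topologicalGroup_of_lieGroup 𝓘(ℝ, E) ∞ (G := G)
  set c := chartAt E (1 : G) with hc
  have h1s : (1 : G) ∈ c.source := mem_chart_source E (1 : G)
  have h1t : c 1 ∈ c.target := c.map_source h1s
  have hsymm1 : c.symm (c 1) = 1 := c.left_inv h1s
  have htarget : c.target ∈ nhds (c 1) := c.open_target.mem_nhds h1t
  set P : E × E → G := fun p => (c.symm p.1)⁻¹ * c.symm p.2 with hP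
  have hP1 : P (c 1, c 1) = 1 := by simp [hP]
  have hsymm : ContMDiffAt 𝓘(ℝ, E) 𝓘(ℝ, E) ∞ c.symm (c 1) :=
    (contMDiffOn_chart_symm (I := 𝓘(ℝ, E)) (x := (1 : G))).contMDiffAt htarget
  have hfst : ContMDiffAt 𝓘(ℝ, E × E) 𝓘(ℝ, E) ∞ (Prod.fst : E × E → E) (c 1, c 1) :=
    contDiffAt_fst.contMDiffAt
  have hsnd : ContMDiffAt 𝓘(ℝ, E × E) 𝓘(ℝ, E) ∞ (Prod.snd : E × E → E) (c 1, c 1) :=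
    contDiffAt_snd.contMDiffAt
  have hPs : ContMDiffAt 𝓘(ℝ, E × E) 𝓘(ℝ, E) ∞ P (c 1, c 1) :=
    (ContMDiffAt.inv (ContMDiffAt.comp (c 1, c 1) (g := c.symm) hsymm hfst)).mul
      (ContMDiffAt.comp (c 1, c 1) (g := c.symm) hsymm hsnd)
  have hchart : ContMDiffAt 𝓘(ℝ, E) 𝓘(ℝ, E) ∞ c (P (c 1, c 1)) := by
    rw [hP1]
    exact (contMDiffOn_chart (I := 𝓘(ℝ, E)) (x := (1 : G))).contMDiffAt (c.open_source.mem_nhds h1s)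
  have hF : ContDiffAt ℝ 1 (c ∘ P) (c 1, c 1) :=
    (contMDiffAt_iff_contDiffAt.1 (hchart.comp (c 1, c 1) hPs)).of_le (by simp)
  obtain ⟨K, t, ht, hK⟩ := hF.exists_lipschitzOnWith
  have hPsource : ∀ᶠ p in nhds (c 1, c 1), P p ∈ c.source := by
    refine hPs.continuousAt.eventually (c.open_source.mem_nhds ?_)
    rwa [hP1]
  have hev : ∀ᶠ p in nhds (c 1, c 1), p ∈ t ∧ P p ∈ c.source ∧ p.1 ∈ c.target := by
    filter_upwards [ht, hPsource, continuousAt_fst.eventually htarget] with p h1 h2 h3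
    exact ⟨h1, h2, h3⟩
  obtain ⟨ρ, hρ, hball⟩ := Metric.eventually_nhds_iff_ball.1 hev
  have hmem : ∀ u ∈ Metric.ball (c 1) ρ, ∀ v ∈ Metric.ball (c 1) ρ,
      (u, v) ∈ Metric.ball (c 1, c 1) ρ := fun u hu v hv => by
    rw [← ball_prod_same]
    exact ⟨hu, hv⟩
  refine ⟨K, K.2, ρ, hρ, fun u hu => (hball _ (hmem u hu u hu)).2.2, fun u hu v hv => ?_⟩
  obtain ⟨h1, h2, -⟩ := hball _ (hmem u hu v hv)
  obtain ⟨h3, -, -⟩ := hball _ (hmem u hu u hu)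
  refine ⟨h2, ?_⟩
  have h4 := hK.dist_le_mul _ h1 _ h3
  have h5 : (c ∘ P) (u, u) = c 1 := by simp [hP]
  rw [h5, dist_eq_norm, dist_eq_norm, Prod.mk_sub_mk, sub_self, Prod.norm_mk, norm_zero,
    max_eq_right (norm_nonneg _)] at h4
  exact h4

/-- Every element of a connected Lie group is a product of at most `C * N` elements at distance at
most `1 / N` from `1`, with `C` independent of `N`. -/
theorem exists_list_isNearOne_prod_eq [ConnectedSpace G] (g : G) :
    ∃ C : ℕ, ∀ N : ℕ, 0 < N → ∃ l : List G, l.length ≤ C * N ∧ l.prod = g ∧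
      ∀ x ∈ l, IsNearOne E (1 / N) x := by
  have := topologicalGroup_of_lieGroup 𝓘(ℝ, E) ∞ (G := G)
  set P : G → Prop := fun g => ∃ C : ℕ, ∀ N : ℕ, 0 < N → ∃ l : List G, l.length ≤ C * N ∧
    l.prod = g ∧ ∀ x ∈ l, IsNearOne E (1 / N) x with hP
  have hmul : ∀ x y, P x → P y → P (x * y) := by
    rintro x y ⟨C, hC⟩ ⟨D, hD⟩
    refine ⟨C + D, fun N hN => ?_⟩
    obtain ⟨l, hl, rfl, hl1⟩ := hC N hN
    obtain ⟨m, hm, rfl, hm1⟩ := hD N hN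
    refine ⟨l ++ m, by rw [List.length_append, add_mul]; omega, List.prod_append, fun x hx => ?_⟩
    rcases List.mem_append.1 hx with h | h
    exacts [hl1 x h, hm1 x h]
  have hone : P 1 := ⟨0, fun N _ => ⟨[], by simp, by simp, by simp⟩⟩
  have hloc : ∀ᶠ x : G in nhds 1, P x := by
    obtain ⟨K, hK0, ρ, hρ, -, hK⟩ := exists_isNearOne_inv_mul (E := E) (G := G)
    filter_upwards [eventually_isNearOne (E := E) (half_pos hρ)] with x hx
    set c := chartAt E (1 : G) with hc
    -- The chart segment from `1` to `x` is cut into `M = C * N` equal pieces, and the quotients of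
    -- consecutive points telescope to `x`. `C ≥ K * ρ` makes each quotient of size at most `1 / N`;
    -- the `+ 1` keeps `M` positive.
    obtain ⟨C, hC⟩ := exists_nat_ge (K * ρ + 1)
    refine ⟨C, fun N hN => ?_⟩
    have hC0 : (0 : ℝ) < C := lt_of_lt_of_le (by positivity) hC
    have hN0 : (0 : ℝ) < N := Nat.cast_pos.2 hN
    set M := C * N with hM
    have hM0 : (0 : ℝ) < M := by rw [hM]; push_cast; positivity
    set u : ℕ → E := fun i => c 1 + ((i : ℝ) / M) • (c x - c 1) with hu
    have hub : ∀ i, i ≤ M → u i ∈ Metric.ball (c 1) ρ := by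
      intro i hi
      rw [mem_ball_iff_norm, hu]
      simp only [add_sub_cancel_left]
      rw [norm_smul, Real.norm_of_nonneg (by positivity)]
      have h1 : (i : ℝ) / M ≤ 1 := (div_le_one hM0).2 (Nat.cast_le.2 hi)
      have h2 := mul_le_mul h1 hx.2 (norm_nonneg _) zero_le_one
      linarith
    refine ⟨(List.range M).map fun i => (c.symm (u i))⁻¹ * c.symm (u (i + 1)), by simp, ?_, ?_⟩
    · rw [prod_range_inv_mul fun i => c.symm (u i)]
      have h0 : u 0 = c 1 := by simp [hu]
      have h1 : u M = c x := by simp [hu, div_self hM0.ne']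
      rw [h0, h1, c.left_inv (mem_chart_source E (1 : G)), c.left_inv hx.1, inv_one, one_mul]
    · intro y hy
      obtain ⟨i, hi, rfl⟩ := List.mem_map.1 hy
      rw [List.mem_range] at hi
      refine (hK _ (hub i hi.le) _ (hub (i + 1) hi)).mono ?_
      have h1 : u (i + 1) - u i = (1 / (M : ℝ)) • (c x - c 1) := by
        simp only [hu]
        rw [add_sub_add_left_eq_sub, ← sub_smul]
        congr 1
        push_cast
        ring
      rw [h1, norm_smul, Real.norm_of_nonneg (by positivity)]
      have h2 : K * ‖c x - c 1‖ ≤ C := by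
        have := mul_le_mul_of_nonneg_left hx.2 hK0
        nlinarith
      calc K * (1 / (M : ℝ) * ‖c x - c 1‖) = (K * ‖c x - c 1‖) / M := by ring
        _ ≤ C / M := by gcongr
        _ = 1 / N := by rw [hM]; push_cast; field_simp
  -- The property passes to products but not visibly to inverses, hence the symmetric neighbourhood.
  -- It generates an open, therefore also closed, subgroup, which is all of `G` by connectedness.
  set U : Set G := {x | P x ∧ P x⁻¹} with hU
  have hU1 : U ∈ nhds (1 : G) := by
    refine hloc.and ?_
    have h := (continuous_inv (G := G)).continuousAt (x := 1)
    rw [ContinuousAt, inv_one] at h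
    exact h.eventually hloc
  have htop : (Subgroup.closure U : Set G) = Set.univ := by
    have ho : IsOpen (Subgroup.closure U : Set G) :=
      Subgroup.isOpen_of_mem_nhds _ (mem_of_superset hU1 Subgroup.subset_closure)
    exact IsClopen.eq_univ ⟨Subgroup.isClosed_of_isOpen _ ho, ho⟩ ⟨1, one_mem _⟩
  have hg : g ∈ Subgroup.closure U := by
    rw [← SetLike.mem_coe, htop]
    trivial
  suffices h : P g ∧ P g⁻¹ from h.1
  induction hg using Subgroup.closure_induction with
  | mem x hx => exact hx
  | one => exact ⟨hone, by rwa [inv_one]⟩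
  | mul x y _ _ hx hy => exact ⟨hmul _ _ hx.1 hy.1, by rw [mul_inv_rev]; exact hmul _ _ hy.2 hx.2⟩
  | inv x _ hx => exact ⟨hx.2, by rw [inv_inv]; exact hx.1⟩

end LieGroup

end ChartAtOne

theorem MonoidHom.iterate_extends {π G : Type*} [Group π] [Group G] {ι : π →* G}
    {φ : π →* π} {D : G →* G} (h : ∀ x, D (ι x) = ι (φ x)) (n : ℕ)
    (x : π) : D^[n] (ι x) = ι (φ^[n] x) :=
  (Function.Semiconj.iterate_right (f := ι) (fun x => (h x).symm) n x).symm

/-! ### The growth rate is at most `sp(D_*)`. -/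

section Linearization

variable {E : Type*} [NormedAddCommGroup E]
  {G : Type*} [TopologicalSpace G] [ChartedSpace E G] [Group G]

/-- The one-step estimate holds only within `δ₀` of `1`; the condition on all `j < m` keeps the
orbit there until the last step. -/
theorem IsNearOne.iterate {ψ : G → G} {δ₀ μ : ℝ} (hμ : 0 ≤ μ)
    (h : ∀ g : G, IsNearOne E δ₀ g →
      IsNearOne E (μ * ‖chartAt E (1 : G) g - chartAt E (1 : G) 1‖) (ψ g))
    {δ : ℝ} {m : ℕ} (hm : ∀ j < m, μ ^ j * δ ≤ δ₀) {g : G} (hg : IsNearOne E δ g) :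
    IsNearOne E (μ ^ m * δ) (ψ^[m] g) := by
  induction m with
  | zero => simpa using hg
  | succ m ih =>
    have h1 := ih fun j hj => hm j (by omega)
    rw [Function.iterate_succ_apply']
    refine (h _ (h1.mono (hm m (by omega)))).mono ?_
    rw [pow_succ', mul_assoc]
    exact mul_le_mul_of_nonneg_left h1.2 hμ

variable [NormedSpace ℝ E]

/-- The differential at `1` of a map to a vector space, on the model space. -/
noncomputable def derivAtOne (E : Type*) [NormedAddCommGroup E] [NormedSpace ℝ E]
    {G : Type*} [TopologicalSpace G] [ChartedSpace E G] [Group G] {F : Type*}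
    [NormedAddCommGroup F] [NormedSpace ℝ F] (Q : G → F) : E →L[ℝ] F :=
  mfderiv 𝓘(ℝ, E) 𝓘(ℝ, F) Q (1 : G)

/-- The differential at `1` of an endomorphism of a Lie group, on the model space. -/
noncomputable def homDerivAtOne (E : Type*) [NormedAddCommGroup E] [NormedSpace ℝ E]
    {G : Type*} [TopologicalSpace G] [ChartedSpace E G] [Group G] (D : G →* G) : E →L[ℝ] E :=
  mfderiv 𝓘(ℝ, E) 𝓘(ℝ, E) D (1 : G)

theorem hasFDerivAt_derivAtOne {F : Type*} [NormedAddCommGroup F] [NormedSpace ℝ F]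
    {Q : G → F} (hQ : MDifferentiableAt 𝓘(ℝ, E) 𝓘(ℝ, F) Q 1) :
    HasFDerivAt (fun u => Q ((chartAt E (1 : G)).symm u)) (derivAtOne E Q)
      (chartAt E (1 : G) 1) := by
  have h : HasFDerivWithinAt (fun u => Q ((chartAt E (1 : G)).symm u)) (derivAtOne E Q)
    (Set.range 𝓘(ℝ, E)) (chartAt E (1 : G) 1) := hQ.hasMFDerivAt.2
  rwa [ModelWithCorners.range_eq_univ, hasFDerivWithinAt_univ] at h

theorem hasFDerivAt_homDerivAtOne {D : G →* G} (hD : MDifferentiableAt 𝓘(ℝ, E) 𝓘(ℝ, E) D 1) :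
    HasFDerivAt (fun u => chartAt E (1 : G) (D ((chartAt E (1 : G)).symm u)))
      (homDerivAtOne E D) (chartAt E (1 : G) 1) := by
  have h : HasFDerivWithinAt (writtenInExtChartAt 𝓘(ℝ, E) 𝓘(ℝ, E) (1 : G) D) (homDerivAtOne E D)
    (Set.range 𝓘(ℝ, E)) (chartAt E (1 : G) 1) := hD.hasMFDerivAt.2
  have h2 : writtenInExtChartAt 𝓘(ℝ, E) 𝓘(ℝ, E) (1 : G) D =
      fun u => chartAt E (1 : G) (D ((chartAt E (1 : G)).symm u)) := by
    ext u
    simp [writtenInExtChartAt]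
  rwa [ModelWithCorners.range_eq_univ, hasFDerivWithinAt_univ, h2] at h

/-- Near `1`, an iterate of `D` expands distances to `1` at most by any factor larger than the norm
of the corresponding power of the differential. -/
theorem exists_isNearOne_iterate {D : G →* G} (hDc : Continuous D)
    (hD : MDifferentiableAt 𝓘(ℝ, E) 𝓘(ℝ, E) D 1) (n : ℕ) {μ : ℝ}
    (hμ : ‖homDerivAtOne E D ^ n‖ < μ) :
    ∃ δ > 0, ∀ g : G, IsNearOne E δ g →
      IsNearOne E (μ * ‖chartAt E (1 : G) g - chartAt E (1 : G) 1‖) (D^[n] g) := by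
  set c := chartAt E (1 : G) with hc
  set A := homDerivAtOne E D with hA
  set f : E → E := fun u => c (D (c.symm u)) with hf
  have hs1 : (1 : G) ∈ c.source := mem_chart_source E (1 : G)
  have hf1 : f (c 1) = c 1 := by simp only [hf]; rw [c.left_inv hs1, map_one]
  have hfn := (hasFDerivAt_homDerivAtOne hD).iterate hf1 n
  have hlin := hfn.isLittleO.def (sub_pos.2 hμ)
  obtain ⟨δ₁, hδ₁, h₁⟩ := exists_isNearOne_imp hlin
  -- The iterates of `D` read in the chart are the iterates of `f` only while every intermediate
  -- point stays in the chart domain.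
  have hsrc : ∀ᶠ g : G in nhds 1, ∀ j ∈ Finset.range (n + 1), D^[j] g ∈ c.source := by
    rw [eventually_all_finset]
    intro j _
    have h : Tendsto D^[j] (nhds 1) (nhds 1) := by
      have := (hDc.iterate j).tendsto 1
      rwa [iterate_map_one] at this
    exact h.eventually (c.open_source.mem_nhds hs1)
  obtain ⟨δ₂, hδ₂, h₂⟩ := exists_isNearOne_imp_mem (E := E) hsrc
  refine ⟨min δ₁ δ₂, lt_min hδ₁ hδ₂, fun g hg => ?_⟩
  have hg2 : ∀ j ≤ n, D^[j] g ∈ c.source := fun j hj =>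
    h₂ g (hg.mono (min_le_right _ _)) j (Finset.mem_range.2 (Nat.lt_succ_of_le hj))
  have hiter : ∀ j ≤ n, f^[j] (c g) = c (D^[j] g) := by
    intro j hj
    induction j with
    | zero => rfl
    | succ j ih =>
      rw [Function.iterate_succ_apply', ih (by omega), Function.iterate_succ_apply']
      simp only [hf]
      rw [c.left_inv (hg2 j (by omega))]
  refine ⟨hg2 n le_rfl, ?_⟩
  have h3 := h₁ g (hg.mono (min_le_left _ _))
  have h4 : f^[n] (c 1) = c 1 := Function.iterate_fixed hf1 n
  change ‖f^[n] (c g) - f^[n] (c 1) - (A ^ n) (c g - c 1)‖ ≤ (μ - ‖A ^ n‖) * ‖c g - c 1‖ at h3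
  rw [hiter n le_rfl, h4] at h3
  have h5 := (A ^ n).le_opNorm (c g - c 1)
  have h6 := norm_add_le (c (D^[n] g) - c 1 - (A ^ n) (c g - c 1)) ((A ^ n) (c g - c 1))
  rw [sub_add_cancel] at h6
  linarith

variable {π : Type*} [Group π] {S : Set π}

variable [FiniteDimensional ℝ E] [T2Space G] [LieGroup 𝓘(ℝ, E) ∞ G]

/-- The orbits of `φ` grow at most at the rate of the spectral radius of its linearization. -/
theorem OrbitGrowthLE.of_spLinear_lt (hS : Subgroup.closure S = ⊤) {ι : π →* G} {φ : π →* π}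
    {D : G →* G} (hι : IsMalcevCompletion ι) (hD : IsMalcevExtension (E := E) ι φ D) :
    ∀ r > spLinear (linearization E D), ∀ x, OrbitGrowthLE S φ ⊥ r x := by
  intro r hr
  have := topologicalGroup_of_lieGroup 𝓘(ℝ, E) ∞ (G := G)
  have : LocallyCompactSpace G := Manifold.locallyCompact_of_finiteDimensional 𝓘(ℝ, E)
  have := hι.simplyConnected
  have := hι.discrete
  have := hι.cocompact
  obtain ⟨q, hq, hqr⟩ := exists_between hr
  obtain ⟨C₀, hC₀⟩ : ∃ C : ℝ, ∀ k : ℕ,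
      ‖homDerivAtOne E D ^ k‖ ≤ C * q ^ k :=
    exists_norm_toContinuousLinearMap_pow_le (E := E) hq
  have hq0 : 0 < q := (maxAbsRoot_nonneg _).trans_lt hq
  have hr0 : 0 < r := hq0.trans hqr
  obtain ⟨p, hqp, hpr⟩ := exists_between hqr
  obtain ⟨n, hn, hn0⟩ := ((eventually_mul_pow_le_pow hq0.le hqp C₀).and
    (eventually_gt_atTop 0)).exists
  have hμ : ‖homDerivAtOne E D ^ n‖ < r ^ n :=
    ((hC₀ n).trans hn).trans_lt (pow_lt_pow_left₀ hpr (hq0.trans hqp).le hn0.ne')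
  obtain ⟨δ₀, hδ₀, hψ⟩ := exists_isNearOne_iterate hD.smooth.continuous
    (hD.smooth.mdifferentiable (by simp) 1) n hμ
  set μ := r ^ n with hμdef
  have hμ0 : 0 < μ := pow_pos hr0 n
  have hlist : ∀ (m : ℕ) (l : List G), (D^[n])^[m] l.prod = (l.map (D^[n])^[m]).prod := by
    intro m l
    rw [← Function.iterate_mul]
    induction l with
    | nil => simp [iterate_map_one]
    | cons a l ih => rw [List.prod_cons, iterate_map_mul, ih, List.map_cons, List.prod_cons]
  -- For `r < 1`, fix one factorization of `ι γ` into small elements. All factors contract to `1`,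
  -- so the orbit of `ι γ` tends to `1` along multiples of `n`; by discreteness it reaches `1`.
  rcases lt_or_ge r 1 with hr1 | hr1
  · have hμ1 : μ < 1 := pow_lt_one₀ hr0.le hr1 hn0.ne'
    intro γ
    obtain ⟨C, hC⟩ := exists_list_isNearOne_prod_eq (E := E) (ι γ)
    obtain ⟨N, hN⟩ := exists_nat_ge (1 / δ₀)
    have hN0 : (0 : ℝ) < N := lt_of_lt_of_le (by positivity) hN
    obtain ⟨l, -, hl, hlN⟩ := hC N (Nat.cast_pos.1 hN0)
    have hNδ : 1 / (N : ℝ) ≤ δ₀ := (one_div_le hN0 hδ₀).2 hN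
    have htend : ∀ x ∈ l, Tendsto (fun m => (D^[n])^[m] x) atTop (nhds 1) := by
      intro x hx U hU
      obtain ⟨δ, hδ, hδU⟩ := exists_isNearOne_imp_mem (E := E) hU
      have hlim : Tendsto (fun m : ℕ => μ ^ m * (1 / (N : ℝ))) atTop (nhds (0 * (1 / (N : ℝ)))) :=
        (tendsto_pow_atTop_nhds_zero_of_lt_one hμ0.le hμ1).mul_const _
      rw [zero_mul] at hlim
      rw [Filter.mem_map]
      filter_upwards [hlim.eventually (gt_mem_nhds hδ)] with m hm
      refine hδU _ ((IsNearOne.iterate hμ0.le hψ (fun j _ => ?_) (hlN x hx)).mono hm.le)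
      exact (mul_le_of_le_one_left (by positivity) (pow_le_one₀ hμ0.le hμ1.le)).trans hNδ
    have hprod : Tendsto (fun m => ι (φ^[n * m] γ)) atTop (nhds 1) := by
      have h := tendsto_list_prod l htend
      have h1 : (l.map fun _ => (1 : G)).prod = 1 := by simp
      rw [h1] at h
      refine h.congr fun m => ?_
      rw [← MonoidHom.iterate_extends hD.extends_hom, Function.iterate_mul, ← hl, hlist]
    have hiso : ∀ᶠ g : G in nhds 1, g ∈ ι.range → g = 1 := by
      obtain ⟨U, hU, hU1⟩ := isOpen_induced_iff.1
        (isOpen_discrete ({1} : Set ι.range))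
      have h1 : (1 : G) ∈ U := by
        have : (1 : ι.range) ∈ Subtype.val ⁻¹' U := by rw [hU1]; rfl
        exact this
      filter_upwards [hU.mem_nhds h1] with g hg hgι
      have : (⟨g, hgι⟩ : ι.range) ∈ ({1} : Set ι.range) := by rw [← hU1]; exact hg
      exact congrArg Subtype.val this
    obtain ⟨m, hm⟩ := (hprod.eventually hiso).exists
    have h1 := hm ⟨_, rfl⟩
    rw [← map_one ι] at h1
    exact of_iterate_eq_one hr0 (hι.injective h1)
  · have hμ1 : 1 ≤ μ := one_le_pow₀ hr1
    obtain ⟨K, hK, hK1⟩ := exists_compact_mem_nhds (1 : G)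
    obtain ⟨δ₁, hδ₁, hδK⟩ := exists_isNearOne_imp_mem (E := E) hK1
    obtain ⟨B, hB⟩ := exists_wordLength_le_of_prod_eq hι.injective hS hK
    set δ := min δ₀ δ₁ with hδdef
    have hδ : 0 < δ := lt_min hδ₀ hδ₁
    refine of_iterate hn0 hr0 fun γ => ?_
    obtain ⟨C, hC⟩ := exists_list_isNearOne_prod_eq (E := E) (ι γ)
    refine ⟨B * (C * (1 / δ + 1) + 1), fun m => ⟨_, by rw [inv_mul_cancel]; exact one_mem _, ?_⟩⟩
    rw [← Function.iterate_mul]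
    have hμm : 1 ≤ μ ^ m := one_le_pow₀ hμ1
    -- The factorization depends on `m`: factors of size `1 / N` are chosen so that `m` expansions
    -- by `μ` leave them within `δ`, hence in `K`. The number of factors, and so the word length, is
    -- `O(μ ^ m)`.
    set N := ⌈μ ^ m / δ⌉₊ with hN
    have hN1 : μ ^ m / δ ≤ N := Nat.le_ceil _
    have hN2 : (N : ℝ) < μ ^ m / δ + 1 := Nat.ceil_lt_add_one (by positivity)
    have hN0 : (0 : ℝ) < N := lt_of_lt_of_le (by positivity) hN1
    obtain ⟨l, hlC, hl, hlN⟩ := hC N (Nat.cast_pos.1 hN0)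
    have hstep : μ ^ m * (1 / (N : ℝ)) ≤ δ := by
      rw [mul_one_div, div_le_iff₀ hN0]
      rwa [div_le_iff₀' hδ] at hN1
    have hle := hB (l.map (D^[n])^[m]) (fun y hy => by
      obtain ⟨x, hx, rfl⟩ := List.mem_map.1 hy
      refine hδK _ ((IsNearOne.iterate hμ0.le hψ (fun j hj => ?_) (hlN x hx)).mono
        (hstep.trans (min_le_right _ _)))
      refine le_trans ?_ (hstep.trans (min_le_left _ _))
      exact mul_le_mul_of_nonneg_right (pow_le_pow_right₀ hμ1 hj.le) (by positivity))
      (φ^[n * m] γ) (by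
        rw [← MonoidHom.iterate_extends hD.extends_hom, Function.iterate_mul, ← hl, hlist])
    rw [List.length_map] at hle
    have h1 : (wordLength S (φ^[n * m] γ) : ℝ) ≤ B * (C * N + 1) := by
      have h2 : wordLength S (φ^[n * m] γ) ≤ B * (C * N + 1) :=
        hle.trans (Nat.mul_le_mul_left _ (Nat.add_le_add_right hlC 1))
      exact_mod_cast h2
    refine h1.trans ?_
    rw [mul_assoc]
    refine mul_le_mul_of_nonneg_left ?_ (by positivity)
    have h3 : (C : ℝ) * N ≤ C * (1 / δ + 1) * μ ^ m := by
      rw [mul_assoc]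
      refine mul_le_mul_of_nonneg_left ?_ (by positivity)
      have : (1 / δ + 1) * μ ^ m = μ ^ m / δ + μ ^ m := by ring
      linarith
    linarith

end Linearization

/-- A homomorphism is Lipschitz for word lengths; used to pass from `π` to its abelianization. -/
theorem OrbitGrowthLE.map_bot {π π' : Type*} [Group π] [Group π'] {S : Set π} {S' : Set π'}
    (hS : Subgroup.closure S = ⊤) (hSf : S.Finite) (hS' : Subgroup.closure S' = ⊤) {f : π →* π'}
    {φ : π →* π} {φ' : π' →* π'} (hf : ∀ x, f (φ x) = φ' (f x)) {r : ℝ} {x : π}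
    (h : OrbitGrowthLE S φ ⊥ r x) : OrbitGrowthLE S' φ' ⊥ r (f x) := by
  obtain ⟨C, hC⟩ := h.wordLength_le
  set B : ℝ := ∑ s ∈ hSf.toFinset, (wordLength S' (f s) : ℝ)
  have hB0 : 0 ≤ B := Finset.sum_nonneg fun _ _ => by positivity
  have hlen : ∀ x, (wordLength S' (f x) : ℝ) ≤ B * wordLength S x :=
    le_mul_wordLength hS (by simp)
      (fun x y => by rw [map_mul]; exact_mod_cast wordLength_mul_le hS' (f x) (f y))
      (fun x => by rw [map_inv]; exact_mod_cast wordLength_inv_le hS' (f x))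
      fun s hs => Finset.single_le_sum (f := fun s => (wordLength S' (f s) : ℝ))
        (fun _ _ => by positivity) (hSf.mem_toFinset.2 hs)
  refine ⟨B * C, fun k => ⟨_, by rw [inv_mul_cancel]; exact one_mem _, ?_⟩⟩
  rw [← Function.Semiconj.iterate_right (f := f) hf k x, mul_assoc]
  exact (hlen _).trans (mul_le_mul_of_nonneg_left (hC k) hB0)

/-! ### Block form from an intertwining relation. -/

section BlockMatrix

variable {V : Type*} [AddCommGroup V] [Module ℝ V] {k : ℕ}

/-- A linear section of `q` splits `V` as `ℝᵏ ⊕ ker q`. In the resulting basis the first `k`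
coordinates of `v` are those of `q v`, so the intertwining relation determines the upper blocks. -/
theorem HasFirstDiagonalBlock.of_surjective [FiniteDimensional ℝ V] {T : V →ₗ[ℝ] V}
    {q : V →ₗ[ℝ] (Fin k → ℝ)} (hq : Function.Surjective q) {D : Matrix (Fin k) (Fin k) ℤ}
    (h : ∀ v, q (T v) = (D.map (Int.cast : ℤ → ℝ)).mulVec (q v)) :
    HasFirstDiagonalBlock T q D := by
  obtain ⟨s, hs⟩ := q.exists_rightInverse_of_surjective (LinearMap.range_eq_top.2 hq)
  have hs' : ∀ x, q (s x) = x := fun x => LinearMap.congr_fun hs x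
  set c := Module.finBasis ℝ (LinearMap.ker q)
  set e : ((Fin k → ℝ) × LinearMap.ker q) ≃ₗ[ℝ] V :=
    LinearEquiv.ofBijective (s.coprod (LinearMap.ker q).subtype) (by
      constructor
      · rw [← LinearMap.ker_eq_bot, LinearMap.ker_eq_bot']
        rintro ⟨x, y⟩ hxy
        have h1 : s x + y = 0 := by simpa using hxy
        have h2 : x = 0 := by
          have := congrArg q h1
          rwa [map_add, hs', LinearMap.mem_ker.1 y.2, add_zero, map_zero] at this
        subst h2
        rw [map_zero, zero_add] at h1
        exact Prod.ext rfl (Subtype.ext h1)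
      · intro v
        refine ⟨(q v, ⟨v - s (q v), ?_⟩), by simp⟩
        rw [LinearMap.mem_ker, map_sub, hs', sub_self])
  have he : ∀ p, e p = s p.1 + p.2 := fun p => rfl
  set b := ((Pi.basisFun ℝ (Fin k)).prod c).map e with hb
  have hl : ∀ i, q (b (Sum.inl i)) = Pi.single i 1 := by
    intro i
    simp [hb, he, hs']
  have hr : ∀ j, q (b (Sum.inr j)) = 0 := by
    intro j
    simp [hb, he]
  have hrepr : ∀ v i, b.repr v (Sum.inl i) = q v i := by
    intro v i
    conv_rhs => rw [← b.sum_repr v]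
    rw [map_sum, Fintype.sum_sum_type]
    simp [hl, hr, Finset.sum_apply, Pi.single_apply]
  refine ⟨_, b, (LinearMap.toMatrix b b T).toBlocks₂₁, (LinearMap.toMatrix b b T).toBlocks₂₂,
    hl, hr, ?_⟩
  conv_lhs => rw [← Matrix.fromBlocks_toBlocks (LinearMap.toMatrix b b T)]
  congr 1
  · ext i j
    rw [Matrix.toBlocks₁₁, Matrix.of_apply, LinearMap.toMatrix_apply, hrepr, h, hl,
      Matrix.mulVec_single_one, Matrix.col_apply]
  · ext i j
    rw [Matrix.toBlocks₁₂, Matrix.of_apply, LinearMap.toMatrix_apply, hrepr, h, hr,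
      Matrix.mulVec_zero]
    rfl

end BlockMatrix

/-! ### The projection to `ℝᵏ` and its differential. -/

section Projection

variable {π : Type*} [Group π] {S : Set π} {k : ℕ}
  {E : Type*} [NormedAddCommGroup E] [NormedSpace ℝ E]
  {G : Type*} [TopologicalSpace G] [ChartedSpace E G] [Group G]

/-- A continuous homomorphism to a normed space that vanishes on a cocompact subgroup is zero. -/
theorem eq_zero_of_map_mul_of_cocompact {G F : Type*} [Group G] [TopologicalSpace G]
    [IsTopologicalGroup G] [LocallyCompactSpace G] [NormedAddCommGroup F] [NormedSpace ℝ F]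
    {ι : π →* G} [CompactSpace (G ⧸ ι.range)] {h : G → F} (hc : Continuous h)
    (hmul : ∀ x y, h (x * y) = h x + h y) (hι : ∀ γ, h (ι γ) = 0) (g : G) : h g = 0 := by
  obtain ⟨P, hP, hPG⟩ := exists_isCompact_mul_range (ι := ι)
  obtain ⟨B, hB⟩ := hP.exists_bound_of_continuousOn hc.continuousOn
  -- All values of `h` are attained on a compact set, so `h` is bounded; a bounded homomorphism to a
  -- normed space is zero, as powers of `g` show.
  have hB' : ∀ g, ‖h g‖ ≤ B := by
    intro g
    obtain ⟨f, hf, γ, rfl⟩ := hPG g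
    rw [hmul, hι, add_zero]
    exact hB f hf
  have h1 : h 1 = 0 := by simpa using hmul 1 1
  have hpow : ∀ n : ℕ, h (g ^ n) = (n : ℝ) • h g := by
    intro n
    induction n with
    | zero => simp [h1]
    | succ n ih => rw [pow_succ, hmul, ih]; push_cast; rw [add_smul, one_smul]
  by_contra hne
  have hpos : 0 < ‖h g‖ := norm_pos_iff.2 hne
  obtain ⟨n, hn⟩ := exists_nat_gt (B / ‖h g‖)
  have h2 := hB' (g ^ n)
  rw [hpow, norm_smul, Real.norm_of_nonneg (Nat.cast_nonneg n)] at h2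
  rw [div_lt_iff₀ hpos] at hn
  linarith

/-- A homomorphism from a connected Lie group to `ℝ` with zero differential at `1` is zero. -/
theorem eq_zero_of_map_mul_of_hasFDerivAt_zero [LieGroup 𝓘(ℝ, E) ∞ G] [ConnectedSpace G]
    {h : G → ℝ} (hmul : ∀ x y, h (x * y) = h x + h y)
    (hd : HasFDerivAt (fun u => h ((chartAt E (1 : G)).symm u)) (0 : E →L[ℝ] ℝ)
      (chartAt E (1 : G) 1)) (g : G) : h g = 0 := by
  have h1 : h 1 = 0 := by simpa using hmul 1 1
  obtain ⟨C, hC⟩ := exists_list_isNearOne_prod_eq (E := E) g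
  refine norm_le_zero_iff.1 (le_of_forall_pos_le_add fun ε hε => ?_)
  have hε' : 0 < ε / (C + 1) := by positivity
  -- A zero differential makes `h` at most `ε / (C + 1)` times the size of a small element; `g` has
  -- at most `C * N` factors of size `1 / N`, so the total stays below `ε`.
  obtain ⟨δ, hδ, hδh⟩ := exists_isNearOne_imp (hd.isLittleO.def hε')
  obtain ⟨N, hN⟩ := exists_nat_ge (1 / δ)
  have hN0 : (0 : ℝ) < N := lt_of_lt_of_le (by positivity) hN
  obtain ⟨l, hlC, rfl, hlN⟩ := hC N (Nat.cast_pos.1 hN0)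
  have hx : ∀ x ∈ l, ‖h x‖ ≤ ε / (C + 1) * (1 / N) := by
    intro x hx
    have h2 := hδh x ((hlN x hx).mono ((one_div_le hN0 hδ).2 hN))
    rw [(chartAt E (1 : G)).left_inv (hlN x hx).1,
      (chartAt E (1 : G)).left_inv (mem_chart_source E (1 : G)), h1, sub_zero,
      zero_apply, sub_zero] at h2
    exact h2.trans (mul_le_mul_of_nonneg_left (hlN x hx).2 hε'.le)
  have hsum : ∀ l : List G, (∀ x ∈ l, ‖h x‖ ≤ ε / (C + 1) * (1 / N)) →
      ‖h l.prod‖ ≤ l.length * (ε / (C + 1) * (1 / N)) := by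
    intro l hl
    induction l with
    | nil => simp [h1]
    | cons a l ih =>
      rw [List.prod_cons, hmul, List.length_cons]
      have h3 := ih fun x hx => hl x (List.mem_cons_of_mem _ hx)
      have h4 := hl a (by simp)
      have h5 := norm_add_le (h a) (h l.prod)
      push_cast
      linarith
  refine (hsum l hx).trans ?_
  rw [zero_add]
  have hlC' : (l.length : ℝ) ≤ C * N := mod_cast hlC
  calc (l.length : ℝ) * (ε / (C + 1) * (1 / N)) ≤ C * N * (ε / (C + 1) * (1 / N)) := by gcongr
    _ = ε * (C / (C + 1)) := by field_simp
    _ ≤ ε * 1 := by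
      gcongr
      exact (div_le_one (by positivity)).2 (by linarith)
    _ = ε := mul_one ε

variable [LieGroup 𝓘(ℝ, E) ∞ G] {ι : π →* G} {φ : π →* π} {D : G →* G}
  {e : π ⧸ isolator π ≃* Multiplicative (Fin k → ℤ)} {D₁ : Matrix (Fin k) (Fin k) ℤ}
  {Q : G → (Fin k → ℝ)}

/-- Otherwise a nonzero functional `ℓ` kills the range. Then `ℓ ∘ Q` is a homomorphism with zero
differential, hence zero, although `Q` takes every standard basis vector as a value on the lattice.
-/
theorem IsProjectionExtension.derivAtOne_surjective (hι : IsMalcevCompletion ι)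
    (hQ : IsProjectionExtension (E := E) ι e Q) : Function.Surjective (derivAtOne E Q) := by
  have := hι.simplyConnected
  by_contra hns
  have hlt : LinearMap.range (derivAtOne E Q).toLinearMap < ⊤ :=
    lt_top_iff_ne_top.2 fun htop => hns (LinearMap.range_eq_top.1 htop)
  obtain ⟨ℓ, hℓ, hle⟩ := Submodule.exists_le_ker_of_lt_top _ hlt
  refine hℓ (LinearMap.pi_ext' fun i => LinearMap.ext_ring ?_)
  obtain ⟨x, hx⟩ := freeProjection_surjective e (Multiplicative.ofAdd (Pi.single i 1))
  have hQx : Q (ι x) = Pi.single i 1 := by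
    ext j
    have h1 : e (x : π ⧸ isolator π) = Multiplicative.ofAdd (Pi.single i 1) := hx
    rw [hQ.extends_proj, h1, toAdd_ofAdd, Pi.single_apply, Pi.single_apply]
    split_ifs <;> simp
  have hd := (LinearMap.toContinuousLinearMap ℓ).hasFDerivAt.comp (chartAt E (1 : G) 1)
    (hasFDerivAt_derivAtOne (hQ.smooth.mdifferentiable (by simp) 1))
  have hzero : (LinearMap.toContinuousLinearMap ℓ).comp (derivAtOne E Q) = 0 := by
    ext v
    exact hle (LinearMap.mem_range_self _ v)
  rw [hzero] at hd
  have h2 := eq_zero_of_map_mul_of_hasFDerivAt_zero (h := fun g => ℓ (Q g))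
    (fun x y => by rw [hQ.map_mul, map_add]) hd (ι x)
  rw [hQx] at h2
  simpa using h2

variable [FiniteDimensional ℝ E]

/-- Both sides are continuous homomorphisms in `g` and agree on the lattice, which is cocompact. -/
theorem IsProjectionExtension.comp_eq_mulVec (hι : IsMalcevCompletion ι)
    (hD : IsMalcevExtension (E := E) ι φ D) (hQ : IsProjectionExtension (E := E) ι e Q)
    (h : Represents φ e D₁) (g : G) :
    Q (D g) = (D₁.map (Int.cast : ℤ → ℝ)).mulVec (Q g) := by
  have := topologicalGroup_of_lieGroup 𝓘(ℝ, E) ∞ (G := G)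
  have : LocallyCompactSpace G := Manifold.locallyCompact_of_finiteDimensional 𝓘(ℝ, E)
  have := hι.cocompact
  rw [← sub_eq_zero]
  refine eq_zero_of_map_mul_of_cocompact (ι := ι)
    (h := fun g => Q (D g) - (D₁.map (Int.cast : ℤ → ℝ)).mulVec (Q g)) ?_ ?_ ?_ g
  · have h1 := hQ.smooth.continuous
    have h2 := hD.smooth.continuous
    exact (h1.comp h2).sub (Continuous.matrix_mulVec continuous_const h1)
  · intro x y
    simp only [_root_.map_mul, hQ.map_mul, Matrix.mulVec_add]
    abel
  · intro γ
    ext i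
    have h1 := congrFun (h γ) i
    have h2 : (inducedOnFree φ) (γ : π ⧸ isolator π) = (φ γ : π ⧸ isolator π) := rfl
    rw [h2] at h1
    simp only [Pi.sub_apply, Pi.zero_apply, hD.extends_hom, hQ.extends_proj, h1, Matrix.mulVec,
      dotProduct, Matrix.map_apply]
    push_cast
    exact sub_self _

theorem IsProjectionExtension.derivAtOne_comp (hι : IsMalcevCompletion ι)
    (hD : IsMalcevExtension (E := E) ι φ D) (hQ : IsProjectionExtension (E := E) ι e Q)
    (h : Represents φ e D₁) (v : E) :
    derivAtOne E Q (homDerivAtOne E D v) =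
      (D₁.map (Int.cast : ℤ → ℝ)).mulVec (derivAtOne E Q v) := by
  set c := chartAt E (1 : G) with hc
  have hs1 : (1 : G) ∈ c.source := mem_chart_source E (1 : G)
  have h1 := hasFDerivAt_derivAtOne (hQ.smooth.mdifferentiable (by simp) 1)
  have h2 := hasFDerivAt_homDerivAtOne (hD.smooth.mdifferentiable (by simp) 1)
  set L : (Fin k → ℝ) →L[ℝ] (Fin k → ℝ) :=
    LinearMap.toContinuousLinearMap (Matrix.mulVecLin (D₁.map (Int.cast : ℤ → ℝ))) with hL
  have h3 : HasFDerivAt (fun u => L (Q (c.symm u))) (L.comp (derivAtOne E Q)) (c 1) :=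
    L.hasFDerivAt.comp (c 1) h1
  have h4 : c (D (c.symm (c 1))) = c 1 := by rw [c.left_inv hs1, map_one]
  have h5 : HasFDerivAt (fun u => Q (c.symm (c (D (c.symm u)))))
      ((derivAtOne E Q).comp (homDerivAtOne E D)) (c 1) := by
    refine HasFDerivAt.comp (g := fun u => Q (c.symm u)) (c 1) ?_ h2
    rw [h4]
    exact h1
  -- The identity `Q ∘ D = D₁ Q` read in the chart holds only near `c 1`, where `D` stays in the
  -- chart domain; this suffices for uniqueness of the derivative.
  have hev : (fun u => Q (c.symm (c (D (c.symm u))))) =ᶠ[nhds (c 1)]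
      fun u => L (Q (c.symm u)) := by
    have hcont : Tendsto (fun u => D (c.symm u)) (nhds (c 1)) (nhds 1) := by
      have h6 := c.continuousAt_symm (c.map_source hs1)
      have h7 := (hD.smooth.continuous.continuousAt (x := c.symm (c 1))).comp h6
      rw [ContinuousAt, Function.comp_apply, c.left_inv hs1, map_one] at h7
      exact h7
    filter_upwards [hcont.eventually (c.open_source.mem_nhds hs1)] with u hu
    rw [c.left_inv hu, hQ.comp_eq_mulVec hι hD h]
    rfl
  have h8 := h5.unique (h3.congr_of_eventuallyEq hev)
  exact DFunLike.congr_fun h8 v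

end Projection

/-! ### The theorem. -/

theorem theorem3 {π : Type*} [Group π] [Group.IsNilpotent π]
    (htf : ∀ x : π, IsOfFinOrder x → x = 1)
    (S : Finset π) (hS : Subgroup.closure (S : Set π) = ⊤)
    (T : Finset (Abelianization π))
    (hT : Subgroup.closure (T : Set (Abelianization π)) = ⊤)
    (φ : π →* π) :
    growthRate (S : Set π) φ = growthRate (T : Set (Abelianization π)) (Abelianization.map φ) ∧
    ∀ (k : ℕ) (e : π ⧸ isolator π ≃* Multiplicative (Fin k → ℤ))
      (D₁ : Matrix (Fin k) (Fin k) ℤ), Represents φ e D₁ →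
      growthRate (S : Set π) φ = ENNReal.ofReal (spMatrix D₁) ∧
      ∀ (E : Type*) [NormedAddCommGroup E] [NormedSpace ℝ E] [FiniteDimensional ℝ E]
        (G : Type*) [TopologicalSpace G] [T2Space G] [ChartedSpace E G] [Group G]
        [LieGroup 𝓘(ℝ, E) ∞ G] (ι : π →* G) (D : G →* G),
        IsMalcevCompletion ι → IsMalcevExtension (E := E) ι φ D →
        spMatrix D₁ ≤ spLinear (linearization E D) ∧
        ∀ Q : G → (Fin k → ℝ), IsProjectionExtension (E := E) ι e Q →
          HasFirstDiagonalBlock (linearization E D) (differentialAtOne E Q) D₁ := by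

  have hSf : (S : Set π).Finite := S.finite_toSet
  have hTf : (T : Set (Abelianization π)).Finite := T.finite_toSet
  have hle : ∀ (k : ℕ) (e : π ⧸ isolator π ≃* Multiplicative (Fin k → ℤ))
      (D₁ : Matrix (Fin k) (Fin k) ℤ), Represents φ e D₁ →
      ∀ r > spMatrix D₁, ∀ x, OrbitGrowthLE (S : Set π) φ ⊥ r x := fun k e D₁ h =>
    OrbitGrowthLE.of_spMatrix_lt htf hS hSf (freeProjection_surjective e) (ker_freeProjection e)
      h.freeProjection_apply
  have heq : ∀ (k : ℕ) (e : π ⧸ isolator π ≃* Multiplicative (Fin k → ℤ))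
      (D₁ : Matrix (Fin k) (Fin k) ℤ), Represents φ e D₁ →
      growthRate (S : Set π) φ = ENNReal.ofReal (spMatrix D₁) := fun k e D₁ h =>
    le_antisymm (growthRate_le_ofReal (maxAbsRoot_nonneg _) (hle k e D₁ h))
      (ofReal_spMatrix_le_growthRate hS hSf (freeProjection_surjective e) h.freeProjection_apply)
  refine ⟨?_, fun k e D₁ h => ⟨heq k e D₁ h, ?_⟩⟩
  · obtain ⟨k, ⟨e⟩⟩ := exists_free_coordinates hS hSf
    obtain ⟨D₁, h⟩ := exists_represents e φ
    rw [heq k e D₁ h]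
    -- The abelianization may have torsion, so its upper bound is inherited from `π` rather than
    -- obtained from the torsion-free case.
    refine le_antisymm ?_ (growthRate_le_ofReal (maxAbsRoot_nonneg _) fun r hr a => ?_)
    · refine ofReal_spMatrix_le_growthRate hT hTf (f := Abelianization.lift (freeProjection e))
        (fun y => ?_) (D := D₁) fun a => ?_
      · obtain ⟨x, rfl⟩ := freeProjection_surjective e y
        exact ⟨Abelianization.of x, Abelianization.lift_apply_of _ _⟩
      · obtain ⟨x, rfl⟩ := QuotientGroup.mk'_surjective (commutator π) a
        exact h.freeProjection_apply x
    · obtain ⟨x, rfl⟩ := QuotientGroup.mk'_surjective (commutator π) a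
      exact (hle k e D₁ h r hr x).map_bot hS hSf hT
        (f := Abelianization.of) (fun x => (Abelianization.map_of φ x).symm)
  · intro E _ _ _ G _ _ _ _ _ ι D hι hD
    refine ⟨?_, fun Q hQ => ?_⟩
    -- The eigenvalue comparison goes through the growth rate, so it does not depend on a map `Q`
    -- being given.
    · refine (ENNReal.ofReal_le_ofReal_iff (maxAbsRoot_nonneg _)).1 ?_
      rw [← heq k e D₁ h]
      exact growthRate_le_ofReal (maxAbsRoot_nonneg _) (OrbitGrowthLE.of_spLinear_lt hS hι hD)
    · exact HasFirstDiagonalBlock.of_surjective (hQ.derivAtOne_surjective hι)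
        (hQ.derivAtOne_comp hι hD h)
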